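/- Let $p$ be a prime number, let $\overline{\mathbb Q}_p$ be an algebraic closure of $\mathbb Q_p$ with its $p$-adic absolute value, ring of integers $\overline{\mathbb Z}_p$ and residue field $\overline{\mathbb F}_p$. Let $\Pi_\natural\subset\Pi$ be finitely generated abelian groups with profinite completions $\pi_\natural\subset\pi$. For an abelian profinite group $G$ write $G^{(p)}$ for its pro-$p$ completion and $G^{(p)}_{\mathbb Q_p}=G^{(p)}\otimes_{\mathbb Z_p}\mathbb Q_p$. Let $\sigma:\pi\to\pi$ be a continuous automorphism such that the induced $\mathbb Q_p$-linear map on $\pi^{(p)}_{\mathbb Q_p}$ is semisimple, stabilizes $\pi^{(p)}_{\natural,\mathbb Q_p}$, is multiplication by $\alpha^{-2}$ on $\pi^{(p)}_{\natural,\mathbb Q_p}$, and induces multiplication by $\alpha^{-1}$ on $(\pi/\pi_\natural)^{(p)}_{\mathbb Q_p}=\pi^{(p)}_{\mathbb Q_p}/\pi^{(p)}_{\natural,\mathbb Q_p}$, where $\alpha\in\mathbb Z_p^\times$ is not a root of unity. A continuous character $\chi:\pi\to\overline{\mathbb Q}_p^\times$ has values in $\overline{\mathbb Z}_p^\times$;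 let $\bar\chi:\pi\to\overline{\mathbb F}_p^\times$ be its reduction. The automorphism $\sigma$ acts on characters of $\pi$ by composition. Let $\mathrm{Char}^\Pi=\operatorname{Spec}(\overline{\mathbb Q}_p[\Pi])$ and let $\varphi:\mathrm{Hom}_{\mathrm{cont}}(\pi,\overline{\mathbb Q}_p^\times)\to\mathrm{Char}^\Pi$ send $\chi$ to the closed point given by the restriction of $\chi$ to $\Pi$. Let $\xi:\pi\to\overline{\mathbb F}_p^\times$ be a continuous character (for the discrete topology on $\overline{\mathbb F}_p^\times$) that is fixed by $\sigma$, and put $F_\xi=\{\chi\in\mathrm{Hom}_{\mathrm{cont}}(\pi,\overline{\mathbb Q}_p^\times):\bar\chi=\xi\}$. Let $S\subset\mathrm{Char}^\Pi$ be a Zariski closed subset such that $\varphi^{-1}(S)\cap F_\xi$ is stabilized by $\sigma$, i.e. $\sigma$ maps this set onto itself. Let $S'$ be an irreducible component of $S$ such that $\varphi^{-1}(S')\cap F_\xi$ is non-empty. Then there is a torsion character $\chi\in\mathrm{Hom}_{\mathrm{cont}}(\pi,\overline{\mathbb Q}_p^\times)$ with $\varphi(\chi)\in S'$ and $\bar\chi=\xi$.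 -/

import Mathlib

open scoped TensorProduct

universe u

noncomputable section

namespace CharVar

/-! ### Pro-`p` completion of an abelian topological group -/

section ProP

variable (p : ℕ)

/-- Open subgroups of `p`-power index of an abelian topological group. -/
abbrev PIndex (G : Type u) [CommGroup G] [TopologicalSpace G] : Type u :=
  {N : OpenSubgroup G // ∃ k : ℕ, (N : Subgroup G).index = p ^ k}

variable {p}
variable {G H K : Type u} [CommGroup G] [TopologicalSpace G] [CommGroup H] [TopologicalSpace H]
  [CommGroup K] [TopologicalSpace K]

/-- The underlying subgroup. -/
def PIndex.sub (N : PIndex p G) : Subgroup G := N.1.toSubgroup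

/-- The finite quotient `G / N`, written additively. -/
def PQuot (N : PIndex p G) : Type u := Additive (G ⧸ N.sub)

instance (N : PIndex p G) : AddCommGroup (PQuot N) :=
  inferInstanceAs (AddCommGroup (Additive (G ⧸ N.sub)))

/-- The exponent `k` with `[G : N] = p ^ k`. -/
def PIndex.exponent (N : PIndex p G) : ℕ := N.2.choose

theorem PQuot.pow_exponent_nsmul (N : PIndex p G) (x : PQuot N) :
    (p ^ N.exponent) • x = 0 := by
  have h : Nat.card (G ⧸ N.sub) = p ^ N.exponent := N.2.choose_spec
  have h2 : (Additive.toMul x : G ⧸ N.sub) ^ (p ^ N.exponent) = 1 := by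
    rw [← h]
    exact pow_card_eq_one'
  exact congrArg Additive.ofMul h2

variable [hp : Fact p.Prime]

/-- A finite abelian group killed by `p ^ k` is a module over `ℤ / p ^ k`, hence over `ℤ_p`. -/
instance (N : PIndex p G) : Module ℤ_[p] (PQuot N) :=
  letI : Module (ZMod (p ^ N.exponent)) (PQuot N) :=
    AddCommGroup.zmodModule (PQuot.pow_exponent_nsmul N)
  Module.compHom (PQuot N) (PadicInt.toZModPow N.exponent)

/-- `ℤ_p` acts on `G / N` through integers that approximate well enough. -/
theorem PQuot.smul_eq_appr (N : PIndex p G) (z : ℤ_[p]) (x : PQuot N) (n : ℕ)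
    (hn : N.exponent ≤ n) : z • x = z.appr n • x := by
  let _ : Module (ZMod (p ^ N.exponent)) (PQuot N) :=
    AddCommGroup.zmodModule (PQuot.pow_exponent_nsmul N)
  have h1 : z • x = PadicInt.toZModPow N.exponent z • x := rfl
  have h2 : PadicInt.toZModPow N.exponent z = ((z.appr n : ℕ) : ZMod (p ^ N.exponent)) := by
    have h3 : z - (z.appr n : ℤ_[p]) ∈ RingHom.ker (PadicInt.toZModPow (p := p) N.exponent) := by
      rw [PadicInt.ker_toZModPow]
      exact Ideal.span_singleton_le_span_singleton.2 (pow_dvd_pow _ hn) (PadicInt.appr_spec n z)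
    rw [RingHom.mem_ker, map_sub, map_natCast, sub_eq_zero] at h3
    exact h3
  rw [h1, h2, Nat.cast_smul_eq_nsmul]

/-- Additive maps between such quotients are automatically `ℤ_p`-linear. -/
def PQuot.linearOfAdd {N : PIndex p G} {M : PIndex p H} (f : PQuot N →+ PQuot M) :
    PQuot N →ₗ[ℤ_[p]] PQuot M where
  toFun := f
  map_add' := f.map_add
  map_smul' z x := by
    rw [PQuot.smul_eq_appr N z x _ (le_max_left N.exponent M.exponent), map_nsmul,
      RingHom.id_apply, PQuot.smul_eq_appr M z _ _ (le_max_right N.exponent M.exponent)]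

/-- The map `G / N → H / M` induced by a homomorphism `f : G → H` with `f(N) ⊆ M`. -/
def PQuot.map {N : PIndex p G} {M : PIndex p H} (f : G →* H) (h : N.sub ≤ M.sub.comap f) :
    PQuot N →ₗ[ℤ_[p]] PQuot M :=
  PQuot.linearOfAdd (MonoidHom.toAdditive (QuotientGroup.map N.sub M.sub f h))

theorem PQuot.map_map {N : PIndex p G} {M : PIndex p H} {L : PIndex p K} (f : G →* H) (g : H →* K)
    (h : N.sub ≤ M.sub.comap f) (h' : M.sub ≤ L.sub.comap g)
    (h'' : N.sub ≤ L.sub.comap (g.comp f)) (x : PQuot N) :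
    PQuot.map g h' (PQuot.map f h x) = PQuot.map (g.comp f) h'' x :=
  QuotientGroup.induction_on (C := fun y : G ⧸ N.sub =>
    PQuot.map g h' (PQuot.map f h (Additive.ofMul y)) =
      PQuot.map (g.comp f) h'' (Additive.ofMul y)) (Additive.toMul x) fun _ => rfl

/-- The transition map `G / N → G / M` for `N ⊆ M`. -/
def PQuot.transition {N M : PIndex p G} (h : N.sub ≤ M.sub) : PQuot N →ₗ[ℤ_[p]] PQuot M :=
  PQuot.map (MonoidHom.id G) (fun _ hx => h hx)

variable (p G) in
/-- The pro-`p` completion `G^(p) = lim G / N`, over the open subgroups `N` of `p`-power index,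
as a `ℤ_p`-module. -/
def ProP : Submodule ℤ_[p] (∀ N : PIndex p G, PQuot N) where
  carrier := {x | ∀ (N M : PIndex p G) (h : N.sub ≤ M.sub),
    PQuot.transition h (x N) = x M}
  add_mem' := by
    intro x y hx hy N M h
    simp only [Pi.add_apply, map_add, hx N M h, hy N M h]
  zero_mem' := by
    intro N M h
    simp only [Pi.zero_apply, map_zero]
  smul_mem' := by
    intro z x hx N M h
    simp only [Pi.smul_apply, map_smul, hx N M h]

/-- The preimage of an open subgroup of `p`-power index. -/
def PIndex.comap (f : G →ₜ* H) (M : PIndex p H) : PIndex p G :=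
  ⟨M.1.comap f.toMonoidHom f.continuous_toFun, by
    obtain ⟨k, hk⟩ := M.2
    have h : ((M.1 : Subgroup H).comap f.toMonoidHom).index ∣ p ^ k := by
      rw [Subgroup.index_comap, ← hk]
      exact Subgroup.relIndex_dvd_index_of_normal _ _
    obtain ⟨j, -, hj⟩ := (Nat.dvd_prime_pow hp.out).1 h
    exact ⟨j, hj⟩⟩

theorem PIndex.sub_comap (f : G →ₜ* H) (M : PIndex p H) :
    (M.comap f).sub = M.sub.comap f.toMonoidHom := rfl

variable (p) in
/-- Functoriality of the pro-`p` completion. -/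
def ProP.map (f : G →ₜ* H) : ProP p G →ₗ[ℤ_[p]] ProP p H where
  toFun x := ⟨fun M => PQuot.map f.toMonoidHom (PIndex.sub_comap f M).le (x.1 (M.comap f)), by
    intro N M h
    have h1 : (N.comap f).sub ≤ (M.comap f).sub := Subgroup.comap_mono h
    have h2 := x.2 (N.comap f) (M.comap f) h1
    have h3 := PQuot.map_map (N := N.comap f) (M := M.comap f) (L := M) (MonoidHom.id G)
      f.toMonoidHom (fun _ hx => h1 hx)
      (PIndex.sub_comap f M).le h1 (x.1 (N.comap f))
    have h4 := PQuot.map_map (N := N.comap f) (M := N) (L := M) f.toMonoidHom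
      (MonoidHom.id H) (PIndex.sub_comap f N).le
      (fun _ hx => h hx) h1 (x.1 (N.comap f))
    exact h4.trans (h3.symm.trans
      (congrArg (PQuot.map f.toMonoidHom (PIndex.sub_comap f M).le) h2))⟩
  map_add' x y := by
    ext M
    exact map_add (PQuot.map f.toMonoidHom (PIndex.sub_comap f M).le) _ _
  map_smul' z x := by
    ext M
    exact map_smul (PQuot.map f.toMonoidHom (PIndex.sub_comap f M).le) _ _

variable (p G) in
/-- The `ℚ_p`-vector space `G^(p) ⊗ ℚ_p`. -/
abbrev ProPRat : Type u := ℚ_[p] ⊗[ℤ_[p]] ProP p G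

variable (p) in
/-- The `ℚ_p`-linear map `G^(p) ⊗ ℚ_p → H^(p) ⊗ ℚ_p` induced by `f`. -/
def ProPRat.map (f : G →ₜ* H) : ProPRat p G →ₗ[ℚ_[p]] ProPRat p H :=
  (ProP.map p f).baseChange ℚ_[p]

end ProP

/-! ### Profinite completion of an abelian group -/

section Profinite

/-- The profinite completion of an abelian group. -/
abbrev Profin (Γ : Type u) [CommGroup Γ] : Type u :=
  ProfiniteGrp.ProfiniteCompletion.completion (GrpCat.of Γ)

variable {Γ Δ : Type u} [CommGroup Γ] [CommGroup Δ]

/-- The canonical homomorphism from a group to its profinite completion. -/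
def Profin.eta : Γ →* Profin Γ := (ProfiniteGrp.ProfiniteCompletion.eta (GrpCat.of Γ)).hom

instance : CommGroup (Profin Γ) where
  mul_comm x y := by
    refine Subtype.ext (funext fun N => ?_)
    exact mul_comm (G := Γ ⧸ N.toSubgroup) (x.1 N) (y.1 N)

/-- Functoriality of the profinite completion. -/
def Profin.map (f : Γ →* Δ) : Profin Γ →ₜ* Profin Δ :=
  (ProfiniteGrp.profiniteCompletion.map (GrpCat.ofHom f)).hom

end Profinite

/-! ### The automorphism with weights -/

section Weights

variable {p : ℕ} [Fact p.Prime] {Γ : Type u} [CommGroup Γ]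

variable (p) in
/-- For a subgroup `Γ₀ ⊆ Γ`, with profinite completions `π₀ ⊆ π`, the subspace
`π₀^(p) ⊗ ℚ_p` of `π^(p) ⊗ ℚ_p`. -/
def natPart (Γ₀ : Subgroup Γ) : Submodule ℚ_[p] (ProPRat p (Profin Γ)) :=
  LinearMap.range (ProPRat.map p (Profin.map Γ₀.subtype))

variable (p) in
/-- The endomorphism of `π^(p) ⊗ ℚ_p` induced by a continuous automorphism of `π`. -/
def inducedEnd (σ : Profin Γ ≃ₜ* Profin Γ) : Module.End ℚ_[p] (ProPRat p (Profin Γ)) :=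
  ProPRat.map p (σ : Profin Γ →ₜ* Profin Γ)

/-- The automorphism `σ` of `π` acts semisimply on `π^(p) ⊗ ℚ_p`, it stabilizes
`π₀^(p) ⊗ ℚ_p`, on which it is multiplication by `α⁻²`, and it is multiplication by `α⁻¹` on the
quotient; here `α` is a `p`-adic unit that is not a root of unity. -/
structure HasWeights (Γ₀ : Subgroup Γ) (σ : Profin Γ ≃ₜ* Profin Γ) (α : ℤ_[p]ˣ) : Prop where
  not_root_of_unity : ¬ IsOfFinOrder α
  semisimple : (inducedEnd p σ).IsSemisimple
  stable : ∀ v ∈ natPart p Γ₀, inducedEnd p σ v ∈ natPart p Γ₀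
  on_sub : (inducedEnd p σ).restrict stable = (((α⁻¹ ^ 2 : ℤ_[p]ˣ) : ℤ_[p]) : ℚ_[p]) • LinearMap.id
  on_quotient : (natPart p Γ₀).mapQ (natPart p Γ₀) (inducedEnd p σ) stable =
    (((α⁻¹ : ℤ_[p]ˣ) : ℤ_[p]) : ℚ_[p]) • LinearMap.id

end Weights

/-! ### Characters, residue characters and the character variety -/

section Characters

variable (p : ℕ) [Fact p.Prime]

/-- The ring of integers of `PadicAlgCl p`. -/
def integers : ValuationSubring (PadicAlgCl p) := Valued.v.valuationSubring

/-- The residue field of the ring of integers of `PadicAlgCl p`; it is an algebraic closure of the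
field with `p` elements. -/
abbrev ResField : Type := IsLocalRing.ResidueField (integers p)

variable {p}

/-- A continuous character of a compact group has values in the units of the ring of integers. -/
theorem mem_unitGroup {G : Type u} [Group G] [TopologicalSpace G] [CompactSpace G]
    (χ : G →ₜ* (PadicAlgCl p)ˣ) (g : G) : χ g ∈ (integers p).unitGroup := by
  obtain ⟨C, hC⟩ : ∃ C : ℝ, ∀ g : G, ‖((χ g : (PadicAlgCl p)ˣ) : PadicAlgCl p)‖ ≤ C := by
    have hcont : Continuous fun g : G => ‖((χ g : (PadicAlgCl p)ˣ) : PadicAlgCl p)‖ :=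
      (Units.continuous_val.comp χ.continuous_toFun).norm
    obtain ⟨C, hC⟩ := (isCompact_range hcont).bddAbove
    exact ⟨C, fun g => hC ⟨g, rfl⟩⟩
  have hle : ∀ g : G, ‖((χ g : (PadicAlgCl p)ˣ) : PadicAlgCl p)‖ ≤ 1 := by
    intro g
    by_contra! h
    obtain ⟨n, hn⟩ := pow_unbounded_of_one_lt C h
    have := hC (g ^ n)
    rw [map_pow, Units.val_pow_eq_pow_val, norm_pow] at this
    linarith
  have hmem : ∀ g : G, ((χ g : (PadicAlgCl p)ˣ) : PadicAlgCl p) ∈ integers p := by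
    intro g
    rw [integers, Valuation.mem_valuationSubring_iff, PadicAlgCl.valuation_def]
    exact_mod_cast hle g
  rw [ValuationSubring.mem_unitGroup_iff]
  have h1 := (ValuationSubring.valuation_le_one_iff _ _).2 (hmem g)
  have h2 := (ValuationSubring.valuation_le_one_iff _ _).2 (hmem g⁻¹)
  refine le_antisymm h1 ?_
  rw [map_inv, Units.val_inv_eq_inv_val, map_inv₀] at h2
  have h0 : (integers p).valuation ((χ g : (PadicAlgCl p)ˣ) : PadicAlgCl p) ≠ 0 :=
    (Valuation.ne_zero_iff _).2 (Units.ne_zero _)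
  exact (inv_le_one₀ (zero_lt_iff.2 h0)).1 h2

/-- The residue character of a continuous character. -/
def residueChar {G : Type u} [Group G] [TopologicalSpace G] [CompactSpace G]
    (χ : G →ₜ* (PadicAlgCl p)ˣ) : G →* (ResField p)ˣ :=
  (integers p).unitGroupToResidueFieldUnits.comp
    (χ.toMonoidHom.codRestrict (integers p).unitGroup (mem_unitGroup χ))

variable (Γ : Type u) [CommGroup Γ]

/-- The character variety `Spec A[Γ]` of an abelian group `Γ` over `A`, as a topological space. -/
abbrev CharSpace (A : Type*) [CommRing A] : Type _ := PrimeSpectrum (MonoidAlgebra A Γ)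

variable {Γ}

/-- The closed point of the character variety over a field given by a character. -/
def pointOf {K : Type*} [Field K] (χ : Γ →* Kˣ) : CharSpace Γ K :=
  ⟨RingHom.ker (MonoidAlgebra.lift K K Γ ((Units.coeHom K).comp χ)), RingHom.ker_isPrime _⟩

/-- The map `φ` from continuous characters of the profinite completion of `Γ` to the character
variety of `Γ`. -/
def phi (χ : Profin Γ →ₜ* (PadicAlgCl p)ˣ) : CharSpace Γ (PadicAlgCl p) :=
  pointOf (χ.toMonoidHom.comp Profin.eta)

/-- The characters with residue character `ξ`. -/
def fibre (ξ : Profin Γ →* (ResField p)ˣ) : Set (Profin Γ →ₜ* (PadicAlgCl p)ˣ) :=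
  {χ | residueChar χ = ξ}

/-- The action of an automorphism `σ` of the profinite completion on continuous characters. -/
def act (σ : Profin Γ ≃ₜ* Profin Γ) (χ : Profin Γ →ₜ* (PadicAlgCl p)ˣ) :
    Profin Γ →ₜ* (PadicAlgCl p)ˣ :=
  χ.comp (σ : Profin Γ →ₜ* Profin Γ)

end Characters

/-- `T` is an irreducible component of the subspace `S`. -/
def IsComponentOf {X : Type*} [TopologicalSpace X] (T S : Set X) : Prop :=
  ∃ Z ∈ irreducibleComponents S, Subtype.val '' Z = T

end CharVar

end

noncomputable section
open Filter Topology Polynomial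

/-! ### Points of integral extensions -/

/-! The Teichmüller lift `T` of `ξ` is a `σ`-invariant torsion character, but it need not lie on
`S'`. It is enough to find `w` on `S'` with `w ^ p ^ M = T ^ p ^ M` for some `M`. Such a `w` is
torsion, has values of norm one and so extends to the profinite completion, and it reduces to `ξ`
because `p`-th powers are injective in the residue field.

Write `S'` as the zero locus of a prime `P`, and choose `g ∉ P` such that every point of `S` with `g
≠ 0` lies on `S'`. By Noether normalization, points of an irreducible variety outside a proper
closed subset accumulate `p`-adically at every point (`exists_filter_tendsto_algHom`). Characters
close to a given one on generators have the same reduction, so there is `x` on `S'` with reduction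
`ξ` and `g(x) ≠ 0`. The `σ`-orbit of `x` stays in `S`. It is `p`-adically recurrent along the
multiples of some `m > 0` (`exists_recurrence`), so `g` does not vanish at the iterates `σ^(mk) x`,
and these infinitely many iterates lie on `S'`.

For large `M` the character `(x / T) ^ p ^ M` is uniformly close to `1` and has a continuous
logarithm `l`. The weights give `l ∘ σ^n = b^n l₁ + b^(2n) l₂` with `b = α⁻¹`. Hence the `p ^ M`-th
power of the `n`-th iterate is `T ^ p ^ M * exp (t l₁ + t² l₂)` at `t = b^n`. If `f` composed with
the `p ^ M`-power map lies in `P`, then evaluating `f` along this curve gives a power series in `t`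
with infinitely many zeros in the compact set `ℤ_p`; it therefore vanishes at `t = 0`, that is, at
`T ^ p ^ M`. The power map is integral, so the image of the zero locus of `P` is closed and contains
`T ^ p ^ M`, which produces `w`. -/

theorem exists_ringHom_comp_eq_of_isIntegral {A B k : Type*} [CommRing A] [CommRing B] [Field k]
    [IsAlgClosed k] (f : A →+* B) (hf : f.IsIntegral) (a : A →+* k)
    (h : RingHom.ker f ≤ RingHom.ker a) : ∃ b : B →+* k, b.comp f = a := by
  let _ : Algebra A B := f.toAlgebra
  have _ : Algebra.IsIntegral A B := ⟨hf⟩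
  have _ : (RingHom.ker a).IsPrime := RingHom.ker_isPrime a
  -- Lying over gives a prime `Q` above `ker a`; then `B ⧸ Q` is integral over `A ⧸ ker a` and
  -- embeds in the algebraically closed field `k`.
  obtain ⟨Q, -, hQ, hQa⟩ := Ideal.exists_ideal_over_prime_of_isIntegral (R := A) (S := B)
    (RingHom.ker a) ⊥ (by intro x hx; exact h hx)
  have _ : Q.LiesOver (RingHom.ker a) := ⟨hQa.symm⟩
  let _ : Algebra (A ⧸ RingHom.ker a) k := (RingHom.kerLift a).toAlgebra
  have inj : Function.Injective (algebraMap (A ⧸ RingHom.ker a) k) := RingHom.kerLift_injective a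
  have _ : Module.IsTorsionFree (A ⧸ RingHom.ker a) k :=
    Module.isTorsionFree_iff_algebraMap_injective.2 inj
  have inj' : Function.Injective (algebraMap (A ⧸ RingHom.ker a) (B ⧸ Q)) := by
    exact FaithfulSMul.algebraMap_injective _ _
  have _ : Module.IsTorsionFree (A ⧸ RingHom.ker a) (B ⧸ Q) :=
    Module.isTorsionFree_iff_algebraMap_injective.2 inj'
  let L : (B ⧸ Q) →ₐ[A ⧸ RingHom.ker a] k := IsAlgClosed.lift
  refine ⟨L.toRingHom.comp (Ideal.Quotient.mk Q), ?_⟩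
  ext x
  have := L.commutes (Ideal.Quotient.mk _ x)
  exact this

theorem Polynomial.nnnorm_le_of_isRoot_of_monic {k : Type*} [NormedField k] (q : k[X])
    (hq : q.Monic) (C : NNReal) (h : ∀ j < q.natDegree, ‖q.coeff j‖₊ ≤ C) (y : k)
    (hy : q.IsRoot y) :
    ‖y‖₊ ≤ C + 1 := by
  have h1 := hy.norm_lt_cauchyBound hq.ne_zero
  have h2 : q.cauchyBound ≤ C + 1 := by
    rw [Polynomial.cauchyBound, hq.leadingCoeff, nnnorm_one, div_one]
    gcongr
    exact Finset.sup_le fun j hj => h j (Finset.mem_range.1 hj)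
  exact h1.le.trans h2

/-- If the values of a product of finitely many functions tend to zero along an ultrafilter, so do
the values of one of the factors. -/
theorem Ultrafilter.exists_tendsto_zero_of_prod {ι k : Type*} [NormedField k] (U : Ultrafilter ι)
    (z : ι → k) (s : Multiset k)
    (h : Tendsto (fun i => (s.map fun y => z i - y).prod) U (𝓝 0)) :
    ∃ y ∈ s, Tendsto z U (𝓝 y) := by
  induction s using Multiset.induction with
  | empty =>
    simp only [Multiset.map_zero, Multiset.prod_zero] at h
    exact absurd (tendsto_nhds_unique h tendsto_const_nhds) zero_ne_one
  | cons a s ih =>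
    by_cases ha : Tendsto z U (𝓝 a)
    · exact ⟨a, Multiset.mem_cons_self a s, ha⟩
    · have : ∃ ε > 0, ¬ ∀ᶠ i in (U : Filter ι), dist (z i) a < ε := by
        simpa [Metric.tendsto_nhds] using ha
      obtain ⟨ε, hε, h1⟩ := this
      -- Along an ultrafilter, a factor that does not tend to zero is eventually bounded below by
      -- `ε`, so it can be divided out of the product.
      rw [← Ultrafilter.eventually_not] at h1
      obtain ⟨y, hy, hy'⟩ := ih (by
        rw [tendsto_zero_iff_norm_tendsto_zero] at h ⊢
        refine squeeze_zero' (Eventually.of_forall fun _ => norm_nonneg _) (g := fun i =>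
          ε⁻¹ * ‖((a ::ₘ s).map fun y => z i - y).prod‖) ?_ (by simpa using h.const_mul ε⁻¹)
        filter_upwards [h1] with i hi
        rw [Multiset.map_cons, Multiset.prod_cons, norm_mul, ← mul_assoc]
        rw [dist_eq_norm, not_lt] at hi
        refine le_mul_of_one_le_left (norm_nonneg _) ?_
        rwa [← div_eq_inv_mul, one_le_div hε])
      exact ⟨y, Multiset.mem_cons_of_mem hy, hy'⟩

/-- The values `x i r` are roots of monic polynomials whose coefficients converge. They are
therefore bounded, and the limit polynomial tends to zero along them. Since it splits, the
ultrafilter selects one of its roots as the limit. -/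
theorem exists_tendsto_of_isIntegralElem {ι A R k : Type*} [CommRing A] [CommRing R]
    [NormedField k] [IsAlgClosed k] (f : A →+* R) (U : Ultrafilter ι) (x : ι → R →+* k)
    (a : A →+* k) (hx : ∀ c, Tendsto (fun i => x i (f c)) U (𝓝 (a c))) (r : R)
    (hr : f.IsIntegralElem r) : ∃ y, Tendsto (fun i => x i r) U (𝓝 y) := by
  obtain ⟨q, hq, hqr⟩ := hr
  set q0 : k[X] := q.map a with hq0
  set z : ι → k := fun i => x i r with hz
  have hroot : ∀ i, (q.map ((x i).comp f)).IsRoot (z i) := by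
    intro i
    rw [IsRoot, eval_map, hz, ← hom_eval₂, hqr, map_zero]
  have hbd : ∃ C : NNReal, ∀ᶠ i in (U : Filter ι), ‖z i‖₊ ≤ C := by
    refine ⟨(∑ j ∈ Finset.range q.natDegree, (‖a (q.coeff j)‖₊ + 1)) + 1, ?_⟩
    have h1 : ∀ᶠ i in (U : Filter ι), ∀ j ∈ Finset.range q.natDegree,
        ‖x i (f (q.coeff j))‖₊ < ‖a (q.coeff j)‖₊ + 1 := by
      rw [eventually_all_finset]
      intro j _
      exact (hx (q.coeff j)).nnnorm.eventually_lt_const (lt_add_one _)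
    filter_upwards [h1] with i hi
    refine nnnorm_le_of_isRoot_of_monic _ (hq.map _) _ ?_ _ (hroot i)
    · intro j hj
      rw [hq.natDegree_map] at hj
      rw [coeff_map, RingHom.comp_apply]
      refine (hi j (Finset.mem_range.2 hj)).le.trans ?_
      exact Finset.single_le_sum (f := fun j => ‖a (q.coeff j)‖₊ + 1) (fun j _ => by positivity)
        (Finset.mem_range.2 hj)
  obtain ⟨C, hC⟩ := hbd
  have hlim : Tendsto (fun i => eval (z i) q0) U (𝓝 0) := by
    -- Subtracting the vanishing value of the `i`-th polynomial at `z i` leaves coefficient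
    -- differences, which tend to zero, times bounded powers.
    have h1 : ∀ i, eval (z i) q0 = ∑ j ∈ Finset.range (q.natDegree + 1),
        (a (q.coeff j) - x i (f (q.coeff j))) * z i ^ j := by
      intro i
      have h2 : eval (z i) (q.map ((x i).comp f)) = 0 := hroot i
      rw [eval_map, eval₂_eq_sum_range] at h2
      rw [hq0, eval_map, eval₂_eq_sum_range, ← sub_zero (∑ j ∈ _, _), ← h2, ← Finset.sum_sub_distrib]
      exact Finset.sum_congr rfl fun j _ => by rw [sub_mul, RingHom.comp_apply]
    simp_rw [h1]
    rw [← Finset.sum_const_zero (s := Finset.range (q.natDegree + 1))]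
    refine tendsto_finsetSum _ fun j _ => ?_
    refine NormedField.tendsto_zero_smul_of_tendsto_zero_of_bounded (𝕜 := k) (E := k) ?_ ?_
    · simpa using (tendsto_const_nhds (x := a (q.coeff j))).sub (hx (q.coeff j))
    · refine isBoundedUnder_of_eventually_le (a := C ^ j) ?_
      filter_upwards [hC] with i hi
      simp only [Function.comp_apply, norm_pow]
      have : ‖z i‖ ≤ C := hi
      gcongr
  have hsplit := (IsAlgClosed.splits q0).eq_prod_roots_of_monic (hq.map _)
  obtain ⟨y, -, hy⟩ := U.exists_tendsto_zero_of_prod z q0.roots (by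
    refine hlim.congr fun i => ?_
    conv_lhs => rw [hsplit]
    rw [eval_multiset_prod, Multiset.map_map]
    simp)
  exact ⟨y, hy⟩

/-- Along an ultrafilter, ring homomorphisms out of an integral extension converge pointwise as soon
as their restrictions do. -/
theorem exists_ringHom_tendsto_of_isIntegral {ι A R k : Type*} [CommRing A] [CommRing R]
    [NormedField k] [IsAlgClosed k] (f : A →+* R) (hf : f.IsIntegral) (U : Ultrafilter ι)
    (x : ι → R →+* k) (a : A →+* k) (hx : ∀ c, Tendsto (fun i => x i (f c)) U (𝓝 (a c))) :
    ∃ y : R →+* k, y.comp f = a ∧ ∀ r, Tendsto (fun i => x i r) U (𝓝 (y r)) := by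
  choose y hy using fun r => exists_tendsto_of_isIntegralElem f U x a hx r (hf r)
  refine ⟨⟨⟨⟨y, ?_⟩, ?_⟩, ?_, ?_⟩, ?_, hy⟩
  · exact tendsto_nhds_unique (hy 1) (by simp)
  · intro r s
    exact tendsto_nhds_unique (hy (r * s)) (by simpa using (hy r).mul (hy s))
  · exact tendsto_nhds_unique (hy 0) (by simp)
  · intro r s
    exact tendsto_nhds_unique (hy (r + s)) (by simpa using (hy r).add (hy s))
  · ext c
    exact tendsto_nhds_unique (hy (f c)) (hx c)

/-- Each of finitely many module generators must go to a root of a fixed monic polynomial, and these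
images determine the homomorphism. -/
theorem finite_ringHom_comp_eq {A R k : Type*} [CommRing A] [CommRing R] [Field k]
    (f : A →+* R) (hf : f.Finite) (a : A →+* k) : {y : R →+* k | y.comp f = a}.Finite := by
  let _ : Algebra A R := f.toAlgebra
  have _ : Module.Finite A R := hf
  obtain ⟨s, hs⟩ := (inferInstance : Module.Finite A R).fg_top
  choose q hq hqr using fun r : R => hf.to_isIntegral r
  have hfin : {z : s → k | ∀ r : s, z r ∈ {z : k | z ∈ ((q r).map a).roots}}.Finite :=
    Set.Finite.pi' fun r => Multiset.finite_toSet _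
  refine Set.Finite.of_injOn (f := fun y (r : s) => y r) ?_ ?_ hfin
  · rintro y rfl r
    rw [Set.mem_ofPred_eq, mem_roots (((hq r).map _).ne_zero), IsRoot, eval_map, ← hom_eval₂, hqr,
      map_zero]
  · rintro y hy z hz hyz
    ext r
    have hr : r ∈ Submodule.span A (s : Set R) := hs ▸ Submodule.mem_top
    induction hr using Submodule.span_induction with
    | mem r h => exact congrFun hyz ⟨r, h⟩
    | zero => simp
    | add u v _ _ hu hv => simp [hu, hv]
    | smul c u _ hu =>
      rw [Algebra.smul_def, map_mul, map_mul, hu]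
      congr 1
      exact (DFunLike.congr_fun (hy.trans hz.symm) c)

/-- A point of a finite extension is separated from the other points of its fibre by a function
vanishing at it. -/
theorem exists_separating_fibre {A R k : Type*} [CommRing A] [CommRing R] [Field k] [Algebra k A]
    [Algebra k R] (f : A →ₐ[k] R) (hf : f.Finite) (x : R →ₐ[k] k) :
    ∃ h : R, x h = 0 ∧ ∀ y : R →+* k, y.comp (f : A →+* R) = (x : R →+* k).comp (f : A →+* R) →
      y h = 0 → y = x := by
  classical
  set T : Set (R →+* k) := {y : R →+* k | y.comp (f : A →+* R) = (x : R →+* k).comp (f : A →+* R)}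
  have hT : T.Finite := finite_ringHom_comp_eq _ hf _
  -- A point of the fibre is automatically `k`-linear, since it agrees with `x` on `A`. An inclusion
  -- of kernels therefore forces equality, and prime avoidance applies to the other points.
  have key : ∀ y ∈ T, RingHom.ker (x : R →+* k) ≤ RingHom.ker y → y = x := by
    intro y hy hle
    have hk : ∀ c : k, y (algebraMap k R c) = c := by
      intro c
      have := DFunLike.congr_fun hy (algebraMap k A c)
      simpa using this
    ext r
    have : r - algebraMap k R (x r) ∈ RingHom.ker (x : R →+* k) := by
      simp [RingHom.mem_ker]
    have := hle this
    rw [RingHom.mem_ker, map_sub, hk, sub_eq_zero] at this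
    exact this
  have hnot : ¬ ((RingHom.ker (x : R →+* k) : Set R) ⊆
      ⋃ y ∈ ((hT.toFinset.erase (x : R →+* k) : Finset _) : Set (R →+* k)), (RingHom.ker y : Set R)) := by
    rw [Ideal.subset_union_prime (x : R →+* k) (x : R →+* k)
      (fun y _ _ _ => RingHom.ker_isPrime y)]
    rintro ⟨y, hy, hle⟩
    rw [Finset.mem_erase, Set.Finite.mem_toFinset] at hy
    exact hy.1 (key y hy.2 hle)
  obtain ⟨h, hx, hh⟩ := Set.not_subset.1 hnot
  refine ⟨h, hx, fun y hy hyh => ?_⟩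
  by_contra hne
  refine hh ?_
  simp only [Set.mem_iUnion]
  exact ⟨y, by simpa using ⟨hy, hne⟩, hyh⟩

/-- Up to sign, the constant coefficient is the product of the roots, so they cannot all have norm
at least `ε`. -/
theorem exists_isRoot_norm_lt {k : Type*} [NormedField k] [IsAlgClosed k] (q : k[X])
    (hq : q.Monic) (ε : ℝ) (hε : 0 < ε)
    (h : ‖q.coeff 0‖ < ε ^ q.natDegree) : ∃ y, q.IsRoot y ∧ ‖y‖ < ε := by
  by_contra! hcon
  have hs := IsAlgClosed.splits q
  have h1 := hs.coeff_zero_eq_prod_roots_of_monic hq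
  have h2 : ∀ s : Multiset k, (∀ y ∈ s, ε ≤ ‖y‖) → ε ^ s.card ≤ ‖s.prod‖ := by
    intro s
    induction s using Multiset.induction with
    | empty => simp
    | cons a s ih =>
      intro hs
      rw [Multiset.card_cons, pow_succ', Multiset.prod_cons, norm_mul]
      gcongr
      · exact hs a (Multiset.mem_cons_self a s)
      · exact ih fun y hy => hs y (Multiset.mem_cons_of_mem hy)
  have h3 := h2 q.roots fun y hy => hcon y ((mem_roots hq.ne_zero).1 hy)
  rw [← hs.natDegree_eq_card_roots] at h3
  rw [h1, norm_mul, norm_pow, norm_neg, norm_one, one_pow, one_mul] at h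
  exact absurd h (not_lt.2 h3)

theorem MvPolynomial.exists_mem_nhds_eval_ne_zero {k : Type*} [NontriviallyNormedField k] {d : ℕ}
    (c : MvPolynomial (Fin d) k) (hc : c ≠ 0) (a : Fin d → k) (V : Set (Fin d → k))
    (hV : V ∈ 𝓝 a) : ∃ b ∈ V, MvPolynomial.eval b c ≠ 0 := by
  by_contra! hcon
  obtain ⟨ε, hε, hb⟩ := Metric.mem_nhds_iff.1 hV
  refine hc (MvPolynomial.funext_set (fun i => Metric.ball (a i) ε)
    (fun i => infinite_of_mem_nhds (a i) (Metric.ball_mem_nhds _ hε)) fun x hx => ?_)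
  rw [map_zero]
  refine hcon x (hb ?_)
  rw [ball_pi _ hε]
  exact hx

/-- Over an algebraically closed normed field, the points of an irreducible affine variety outside a
proper closed subvariety accumulate at every point, in the topology of the field. -/
theorem exists_filter_tendsto_algHom {k R : Type*} [NontriviallyNormedField k] [IsAlgClosed k]
    [CommRing R] [IsDomain R] [Algebra k R] [Algebra.FiniteType k R] (x : R →ₐ[k] k) (g : R)
    (hg : g ≠ 0) : ∃ F : Filter (R →ₐ[k] k), F.NeBot ∧ (∀ᶠ y in F, y g ≠ 0) ∧
      ∀ r, Tendsto (fun y : R →ₐ[k] k => y r) F (𝓝 (x r)) := by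
  obtain ⟨d, f, hinj, hfin⟩ := exists_finite_inj_algHom_of_fg k R
  let _ : Algebra (MvPolynomial (Fin d) k) R := f.toRingHom.toAlgebra
  have hint : ∀ r : R, IsIntegral (MvPolynomial (Fin d) k) r := hfin.to_isIntegral
  have _ : FaithfulSMul (MvPolynomial (Fin d) k) R :=
    (faithfulSMul_iff_algebraMap_injective _ _).2 hinj
  obtain ⟨h, hxh, hsep⟩ := exists_separating_fibre f hfin x
  set a : Fin d → k := fun i => x (f (MvPolynomial.X i)) with ha
  set Φ : (R →ₐ[k] k) → (Fin d → k) × k := fun y => (fun i => y (f (MvPolynomial.X i)), y h) with hΦ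
  have hev : ∀ (y : R →ₐ[k] k) (q : MvPolynomial (Fin d) k),
      y (f q) = MvPolynomial.eval (Φ y).1 q := by
    intro y q
    have : y.comp f = MvPolynomial.aeval (Φ y).1 := MvPolynomial.algHom_ext fun i => by simp [hΦ]
    have := DFunLike.congr_fun this q
    simpa [MvPolynomial.aeval_eq_eval] using this
  -- Points near `x` are those whose coordinates in affine space are near `a` and at which the
  -- separating function `h` is small.
  refine ⟨comap Φ (𝓝 (a, 0)) ⊓ 𝓟 {y | y g ≠ 0}, ?_, ?_, ?_⟩
  · rw [inf_principal_neBot_iff]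
    intro W hW
    obtain ⟨V, hV, hVW⟩ := hW
    suffices ∃ y : R →ₐ[k] k, Φ y ∈ V ∧ y g ≠ 0 by
      obtain ⟨y, hy, hy'⟩ := this
      exact ⟨y, hVW hy, hy'⟩
    rw [nhds_prod_eq, mem_prod_iff] at hV
    obtain ⟨V₁, hV₁, V₂, hV₂, hV⟩ := hV
    obtain ⟨ε, hε, hb⟩ := Metric.mem_nhds_iff.1 hV₂
    -- Since `x h = 0`, the constant coefficient of `P` vanishes at `a`. For `b` near `a` it is
    -- small, so the specialization of `P` at `b` has a small root `z`.
    set P := minpoly (MvPolynomial (Fin d) k) h with hP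
    have hPm : P.Monic := minpoly.monic (hint h)
    have hP0 : Tendsto (fun b => ‖MvPolynomial.eval b (P.coeff 0)‖) (𝓝 a) (𝓝 0) := by
      have h1 := (MvPolynomial.continuous_eval (P.coeff 0)).norm.tendsto a
      suffices MvPolynomial.eval a (P.coeff 0) = 0 by rwa [this, norm_zero] at h1
      have h2 : x (f (P.coeff 0)) = 0 := by
        have h3 : aeval h P = 0 := minpoly.aeval _ _
        rw [← divX_mul_X_add P, map_add, map_mul, aeval_X, aeval_C] at h3
        have h4 := congrArg x h3
        rw [map_add, map_mul, hxh, mul_zero, zero_add, map_zero] at h4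
        exact h4
      rwa [hev] at h2
    -- The constant coefficient `c` is a nonzero polynomial vanishing below every zero of `g`, so
    -- `c(b) ≠ 0` guarantees `g ≠ 0` above `b`.
    obtain ⟨Q, hQ, hQg⟩ := (hint g).isAlgebraic.exists_nonzero_coeff_and_aeval_eq_zero
      (mem_nonZeroDivisors_of_ne_zero hg)
    set c := Q.coeff 0 with hc
    have hcg : ∀ y : R →ₐ[k] k, y g = 0 → y (f c) = 0 := by
      intro y hy
      rw [← divX_mul_X_add Q, map_add, map_mul, aeval_X, aeval_C] at hQg
      have h4 := congrArg y hQg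
      rw [map_add, map_mul, hy, mul_zero, zero_add, map_zero] at h4
      exact h4
    have hpos : 0 < ε ^ P.natDegree := by positivity
    obtain ⟨b, ⟨hbV, hbP⟩, hbc⟩ := MvPolynomial.exists_mem_nhds_eval_ne_zero c hQ a _
      (inter_mem hV₁ (hP0.eventually_lt_const hpos))
    have hPb : (P.map (MvPolynomial.eval b)).natDegree = P.natDegree := hPm.natDegree_map _
    obtain ⟨z, hz, hzε⟩ := exists_isRoot_norm_lt (P.map (MvPolynomial.eval b)) (hPm.map _)
      ε hε (by rw [hPb, coeff_map]; exact hbP)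
    -- The polynomial ring is integrally closed, so `P` generates the relations of `h`. Thus `(b,
    -- z)` is a point of the subring generated by `h`, and it lifts to `R` by integrality.
    obtain ⟨y, hy⟩ := exists_ringHom_comp_eq_of_isIntegral
      (aeval (R := MvPolynomial (Fin d) k) h).toRingHom
      (by
        intro r
        obtain ⟨q, hq, hqr⟩ := hint r
        refine ⟨q.map C, hq.map _, ?_⟩
        rw [eval₂_map]
        have h1 : (aeval (R := MvPolynomial (Fin d) k) h).toRingHom.comp C =
            algebraMap (MvPolynomial (Fin d) k) R := RingHom.ext fun q => aeval_C h q
        rw [h1]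
        exact hqr)
      (eval₂RingHom (MvPolynomial.eval b) z) (by
        intro q hq
        have h1 : aeval h q = 0 := hq
        obtain ⟨q', rfl⟩ := minpoly.isIntegrallyClosed_dvd (hint h) h1
        rw [RingHom.mem_ker, map_mul, coe_eval₂RingHom, ← eval_map, hz, zero_mul])
    have hyf : ∀ q, y (f q) = MvPolynomial.eval b q := by
      intro q
      have := DFunLike.congr_fun hy (C q)
      simp only [AlgHom.toRingHom_eq_coe, RingHom.comp_apply, RingHom.coe_coe, aeval_C,
        coe_eval₂RingHom, eval₂_C] at this
      exact this
    have hyh : y h = z := by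
      have := DFunLike.congr_fun hy X
      simpa using this
    let y' : R →ₐ[k] k := ⟨y, by
      intro r
      have := hyf (MvPolynomial.C r)
      rw [MvPolynomial.eval_C] at this
      rw [← MvPolynomial.algebraMap_eq, f.commutes] at this
      exact this⟩
    refine ⟨y', hV ⟨?_, ?_⟩, ?_⟩
    · have : (Φ y').1 = b := by
        ext i
        have := hyf (MvPolynomial.X i)
        rwa [MvPolynomial.eval_X] at this
      rw [this]
      exact hbV
    · refine hb ?_
      rw [mem_ball_zero_iff]
      change ‖y h‖ < ε
      rwa [hyh]
    · intro h0
      refine hbc ?_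
      rw [← hyf]
      exact hcg y' h0
  · exact eventually_inf_principal.2 (Eventually.of_forall fun y hy => hy)
  · intro r
    rw [tendsto_iff_ultrafilter]
    -- Any ultrafilter limit is a point over `a` at which `h` vanishes, hence is `x`.
    intro U hU
    have hUΦ : Tendsto Φ U (𝓝 (a, 0)) := tendsto_comap.mono_left (hU.trans inf_le_left)
    have h1 : Tendsto (fun y => (Φ y).1) U (𝓝 a) := (continuous_fst.tendsto _).comp hUΦ
    have h2 : Tendsto (fun y : R →ₐ[k] k => y h) U (𝓝 0) := (continuous_snd.tendsto _).comp hUΦ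
    obtain ⟨y, hyf, hyr⟩ := exists_ringHom_tendsto_of_isIntegral (f : MvPolynomial (Fin d) k →+* R)
      hfin.to_isIntegral U
      (fun y => (y : R →+* k)) ((x : R →+* k).comp (f : MvPolynomial (Fin d) k →+* R)) (by
        intro q
        have h3 := ((MvPolynomial.continuous_eval q).tendsto a).comp h1
        have h4 : ((x : R →+* k).comp (f : MvPolynomial (Fin d) k →+* R)) q
          = MvPolynomial.eval a q := hev x q
        rw [h4]
        refine h3.congr fun y => ?_
        exact (hev y q).symm)
    have hy : y = x := hsep y hyf (tendsto_nhds_unique (hyr h) h2)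
    have := hyr r
    rw [hy] at this
    exact this

end

noncomputable section
open Filter Topology
open scoped Nat NNReal ENNReal

/-! ### Power series in one variable over a complete field -/

section PowerSeries

variable {K : Type*} [NontriviallyNormedField K]

/-- The function `f` is the sum of a power series that converges absolutely for radius `R`. -/
def IsPowerSeriesSum (f : K → K) (R : ℝ) : Prop :=
  ∃ a : ℕ → K, (Summable fun n => ‖a n‖ * R ^ n) ∧
    ∀ t : K, ‖t‖ < R → HasSum (fun n => a n * t ^ n) (f t)

namespace IsPowerSeriesSum

variable {f g : K → K} {R : ℝ}

theorem zero : IsPowerSeriesSum (0 : K → K) R :=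
  ⟨0, by simp, fun t _ => by simp⟩

theorem add (hf : IsPowerSeriesSum f R) (hg : IsPowerSeriesSum g R) (hR : 0 ≤ R) :
    IsPowerSeriesSum (f + g) R := by
  obtain ⟨a, ha, haf⟩ := hf
  obtain ⟨b, hb, hbg⟩ := hg
  refine ⟨a + b, Summable.of_nonneg_of_le (fun n => by positivity) (fun n => ?_) (ha.add hb),
    fun t ht => ?_⟩
  · rw [← add_mul]
    gcongr
    exact norm_add_le _ _
  · simpa [add_mul] using (haf t ht).add (hbg t ht)

theorem const_mul (c : K) (hf : IsPowerSeriesSum f R) :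
    IsPowerSeriesSum (fun t => c * f t) R := by
  obtain ⟨a, ha, haf⟩ := hf
  refine ⟨fun n => c * a n, ?_, fun t ht => ?_⟩
  · simpa [mul_assoc] using ha.mul_left ‖c‖
  · simpa [mul_assoc] using (haf t ht).mul_left c

theorem sum {ι : Type*} (s : Finset ι) (F : ι → K → K) (hR : 0 ≤ R)
    (h : ∀ i ∈ s, IsPowerSeriesSum (F i) R) : IsPowerSeriesSum (fun t => ∑ i ∈ s, F i t) R := by
  classical
  induction s using Finset.induction_on with
  | empty => exact zero
  | insert i s hi ih =>
    simp_rw [Finset.sum_insert hi]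
    exact (h i (Finset.mem_insert_self i s)).add
      (ih fun j hj => h j (Finset.mem_insert_of_mem hj)) hR

theorem mul [CompleteSpace K] (hf : IsPowerSeriesSum f R) (hg : IsPowerSeriesSum g R) (hR : 0 ≤ R) :
    IsPowerSeriesSum (f * g) R := by
  obtain ⟨a, ha, haf⟩ := hf
  obtain ⟨b, hb, hbg⟩ := hg
  refine ⟨fun n => ∑ kl ∈ Finset.HasAntidiagonal.antidiagonal n, a kl.1 * b kl.2, ?_, fun t ht => ?_⟩
  · have h1 := summable_norm_sum_mul_antidiagonal_of_summable_norm ha.norm hb.norm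
    refine Summable.of_nonneg_of_le (fun n => by positivity) (fun n => ?_) h1.of_norm
    rw [← Real.norm_of_nonneg (pow_nonneg hR n)]
    refine (mul_le_mul_of_nonneg_right (norm_sum_le _ _) (norm_nonneg _)).trans (le_of_eq ?_)
    rw [Finset.sum_mul]
    refine Finset.sum_congr rfl fun kl hkl => ?_
    rw [← Finset.HasAntidiagonal.mem_antidiagonal.1 hkl, Real.norm_of_nonneg (pow_nonneg hR _), norm_mul, pow_add]
    ring
  · have hle : ∀ {c : ℕ → K}, (Summable fun n => ‖c n‖ * R ^ n) →
        Summable fun n => ‖c n * t ^ n‖ := by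
      intro c hc
      refine Summable.of_nonneg_of_le (fun n => norm_nonneg _) (fun n => ?_) hc
      rw [norm_mul, norm_pow]
      gcongr
    have h1 := tsum_mul_tsum_eq_tsum_sum_antidiagonal_of_summable_norm (hle ha) (hle hb)
    have h2 := summable_norm_sum_mul_antidiagonal_of_summable_norm (hle ha) (hle hb)
    rw [(haf t ht).tsum_eq, (hbg t ht).tsum_eq] at h1
    rw [Pi.mul_apply, h1]
    have h3 : ∀ n, (∑ kl ∈ Finset.HasAntidiagonal.antidiagonal n, a kl.1 * b kl.2) * t ^ n =
        ∑ kl ∈ Finset.HasAntidiagonal.antidiagonal n, a kl.1 * t ^ kl.1 * (b kl.2 * t ^ kl.2) := by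
      intro n
      rw [Finset.sum_mul]
      refine Finset.sum_congr rfl fun kl hkl => ?_
      rw [← Finset.HasAntidiagonal.mem_antidiagonal.1 hkl, pow_add]
      ring
    simp_rw [h3]
    exact h2.of_norm.hasSum

theorem hasFPowerSeriesOnBall {R : ℝ≥0} (hR : 0 < R) (hf : IsPowerSeriesSum f R) :
    ∃ q : FormalMultilinearSeries K K K, HasFPowerSeriesOnBall f q 0 R := by
  obtain ⟨a, ha, haf⟩ := hf
  refine ⟨fun n => ContinuousMultilinearMap.mkPiRing K (Fin n) (a n), ?_, by exact_mod_cast hR, ?_⟩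
  · refine FormalMultilinearSeries.le_radius_of_summable _ ?_
    simpa using ha
  · intro t ht
    rw [zero_add]
    have h1 := haf t (by simpa using ht)
    simpa [mul_comm] using h1

/-- The identity theorem: a function given by a power series on a disc of radius larger than two
vanishes at the origin if it vanishes on an infinite subset of a compact subset of the unit disc. -/
theorem apply_zero_eq_zero [CompleteSpace K] {R : ℝ≥0} (hR : 2 < R) (hf : IsPowerSeriesSum f R) {C : Set K}
    (hC : IsCompact C) (hC1 : ∀ t ∈ C, ‖t‖ ≤ 1) {Z : Set K} (hZ : Z.Infinite) (hZC : Z ⊆ C)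
    (hfZ : ∀ t ∈ Z, f t = 0) : f 0 = 0 := by
  obtain ⟨q, hq⟩ := hf.hasFPowerSeriesOnBall (zero_lt_two.trans hR)
  obtain ⟨w, hwC, hw⟩ := hZ.exists_accPt_of_subset_isCompact hC hZC
  have hw1 : ‖w‖₊ ≤ 1 := hC1 w hwC
  have hwR : (‖w‖₊ : ℝ≥0∞) < R := by
    exact_mod_cast hw1.trans_lt (one_lt_two.trans hR)
  have h1 := hq.changeOrigin hwR
  rw [zero_add] at h1
  have h2 : ∃ᶠ z in 𝓝[≠] w, f z = 0 := (accPt_iff_frequently_nhdsNE.1 hw).mono fun z hz => hfZ z hz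
  have h3 := h1.analyticAt.frequently_zero_iff_eventually_zero.1 h2
  have h4 := h1.hasFPowerSeriesAt.eq_zero_of_eventually h3
  rw [h4] at h1
  -- The expansion recentred at the accumulation point `w` is known to converge only on radius `R -
  -- ‖w‖`. Since `‖w‖ ≤ 1`, the condition `R > 2` brings the origin inside.
  have h5 : (0 : K) ∈ Metric.eball w (R - ‖w‖₊) := by
    rw [Metric.mem_eball, edist_comm, edist_zero_right, enorm_eq_nnnorm]
    rw [← ENNReal.coe_sub, ENNReal.coe_lt_coe, lt_tsub_iff_left]
    calc ‖w‖₊ + ‖w‖₊ ≤ 1 + 1 := add_le_add hw1 hw1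
      _ < R := by rwa [one_add_one_eq_two]
  have h6 := h1.hasSum_sub h5
  simp only [FormalMultilinearSeries.zero_apply, zero_apply] at h6
  exact h6.unique hasSum_zero

end IsPowerSeriesSum

/-! ### The exponential function -/

section Exp

theorem le_radius_expSeries {r : ℝ≥0}
    (hr : Summable fun n : ℕ => ‖((n ! : K))⁻¹‖ * (r : ℝ) ^ n) : (r : ℝ≥0∞) ≤ (NormedSpace.expSeries K K).radius := by
  refine FormalMultilinearSeries.le_radius_of_summable _ ?_
  refine Summable.of_nonneg_of_le (fun n => by positivity) (fun n => ?_) hr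
  gcongr
  rw [NormedSpace.expSeries]
  simp [norm_smul]

theorem hasSum_exp_of_norm_lt [CompleteSpace K] [CharZero K] {r : ℝ≥0}
    (hr : Summable fun n : ℕ => ‖((n ! : K))⁻¹‖ * (r : ℝ) ^ n) (x : K) (hx : ‖x‖ < r) :
    HasSum (fun n => (n ! : K)⁻¹ * x ^ n) (NormedSpace.exp x) := by
  have := NormedSpace.expSeries_hasSum_exp_of_mem_ball' (𝕂 := K) x
    (Metric.eball_subset_eball (le_radius_expSeries hr) (by simpa using hx))
  simpa using this

theorem exp_add_of_norm_lt [CompleteSpace K] [CharZero K] {r : ℝ≥0}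
    (hr : Summable fun n : ℕ => ‖((n ! : K))⁻¹‖ * (r : ℝ) ^ n) (x y : K) (hx : ‖x‖ < r) (hy : ‖y‖ < r) :
    NormedSpace.exp (x + y) = NormedSpace.exp x * NormedSpace.exp y :=
  NormedSpace.exp_add_of_mem_ball (𝕂 := K)
    (Metric.eball_subset_eball (le_radius_expSeries hr) (by simpa using hx))
    (Metric.eball_subset_eball (le_radius_expSeries hr) (by simpa using hy))

theorem isPowerSeriesSum_exp_mul [CompleteSpace K] [CharZero K] {r : ℝ≥0}
    (hr : Summable fun n : ℕ => ‖((n ! : K))⁻¹‖ * (r : ℝ) ^ n) {R : ℝ} (hR : 0 < R) (l : K) (hl : ‖l‖ * R < r) :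
    IsPowerSeriesSum (fun t => NormedSpace.exp (t * l)) R := by
  refine ⟨fun n => (n ! : K)⁻¹ * l ^ n, ?_, fun t ht => ?_⟩
  · refine Summable.of_nonneg_of_le (fun n => by positivity) (fun n => ?_) hr
    rw [norm_mul, norm_pow, mul_assoc, ← mul_pow]
    gcongr
  · have h1 : ‖t * l‖ < r := by
      rw [norm_mul, mul_comm]
      exact (mul_le_mul_of_nonneg_left ht.le (norm_nonneg _)).trans_lt hl
    convert hasSum_exp_of_norm_lt hr _ h1 using 2 with n
    rw [mul_pow]
    ring

theorem isPowerSeriesSum_exp_sq_mul [CompleteSpace K] [CharZero K] {r : ℝ≥0}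
    (hr : Summable fun n : ℕ => ‖((n ! : K))⁻¹‖ * (r : ℝ) ^ n) {R : ℝ} (hR : 0 < R) (l : K) (hl : ‖l‖ * R ^ 2 < r) :
    IsPowerSeriesSum (fun t => NormedSpace.exp (t ^ 2 * l)) R := by
  have hinj : Function.Injective fun n : ℕ => 2 * n := fun a b h => by simpa using h
  have hout : ∀ n : ℕ, n ∉ Set.range (fun n : ℕ => 2 * n) → ¬ Even n := by
    rintro n hn ⟨m, rfl⟩
    exact hn ⟨m, (two_mul m)⟩
  refine ⟨fun n => if Even n then ((n / 2) ! : K)⁻¹ * l ^ (n / 2) else 0, ?_, fun t ht => ?_⟩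
  · rw [← hinj.summable_iff (fun n hn => by simp [hout n hn])]
    refine Summable.of_nonneg_of_le (fun n => by simp only [Function.comp_apply]; positivity)
      (fun n => ?_) hr
    simp only [Function.comp_apply, even_two, Even.mul_right, if_true, ne_eq, OfNat.ofNat_ne_zero,
      not_false_eq_true, mul_div_cancel_left₀]
    rw [norm_mul, norm_pow, mul_assoc, pow_mul, ← mul_pow]
    gcongr
  · rw [← hinj.hasSum_iff (fun n hn => by simp [hout n hn])]
    have h1 : ‖t ^ 2 * l‖ < r := by
      rw [norm_mul, norm_pow, mul_comm]
      refine lt_of_le_of_lt ?_ hl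
      gcongr
    convert hasSum_exp_of_norm_lt hr _ h1 using 2 with n
    simp only [Function.comp_apply, even_two, Even.mul_right, if_true, ne_eq, OfNat.ofNat_ne_zero,
      not_false_eq_true, mul_div_cancel_left₀]
    rw [mul_pow, pow_mul]
    ring

/-- The exponential function has a continuous local inverse at `1`. -/
theorem exists_local_log [CompleteSpace K] [CharZero K] {r : ℝ≥0}
    (hr : Summable fun n : ℕ => ‖((n ! : K))⁻¹‖ * (r : ℝ) ^ n) (hr0 : 0 < r) : ∃ L : K → K, L 1 = 0 ∧ ContinuousAt L 1 ∧
    (∀ᶠ u in 𝓝 1, NormedSpace.exp (L u) = u) ∧ ∀ᶠ x in 𝓝 0, L (NormedSpace.exp x) = x := by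
  have h1 : HasStrictDerivAt (NormedSpace.exp : K → K) 1 0 :=
    hasStrictDerivAt_exp_zero_of_radius_pos
      ((ENNReal.coe_pos.2 hr0).trans_le (le_radius_expSeries hr))
  have h2 := h1.hasStrictFDerivAt_equiv one_ne_zero
  have h3 : NormedSpace.exp (0 : K) = 1 := NormedSpace.exp_zero
  refine ⟨h2.localInverse, ?_, ?_, ?_, h2.eventually_left_inverse⟩
  · have := h2.localInverse_apply_image
    rwa [h3] at this
  · have := h2.localInverse_continuousAt
    rwa [h3] at this
  · have := h2.eventually_right_inverse
    rwa [h3] at this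

/-- A multiplicative character with values close to `1` has a logarithm. -/
theorem exists_log_character [CompleteSpace K] [CharZero K] {r : ℝ≥0}
    (hr : Summable fun n : ℕ => ‖((n ! : K))⁻¹‖ * (r : ℝ) ^ n) (hr0 : 0 < r) {δ : ℝ} (hδ : 0 < δ) : ∃ η > 0,
    ∀ {G : Type u} [CommGroup G] (ψ : G →* K), (∀ g, ‖ψ g - 1‖ < η) →
      ∃ l : Additive G →+ K, (∀ g, ‖l g‖ < δ) ∧ (∀ g, NormedSpace.exp (l (Additive.ofMul g)) = ψ g) ∧
        ∀ ε > 0, ∃ η' > 0, ∀ g, ‖ψ g - 1‖ < η' → ‖l (Additive.ofMul g)‖ < ε := by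
  obtain ⟨L, hL1, hLc, hLr, hLl⟩ := exists_local_log hr hr0
  obtain ⟨ρ, hρ, hρL⟩ := Metric.eventually_nhds_iff.1 hLl
  have hc : ∀ ε > 0, ∃ η' > 0, ∀ u : K, ‖u - 1‖ < η' → ‖L u‖ < ε := by
    intro ε hε
    obtain ⟨η', h1, h2⟩ := Metric.continuousAt_iff.1 hLc ε hε
    refine ⟨η', h1, fun u hu => ?_⟩
    have := h2 (x := u) (by rwa [dist_eq_norm])
    rwa [hL1, dist_zero_right] at this
  obtain ⟨η₁, hη₁, h₁⟩ := Metric.eventually_nhds_iff.1 hLr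
  -- Here `δ` is the required bound, `r` makes the exponential additive, and `ρ / 2` keeps a sum of
  -- two logarithms in the ball where `L` inverts the exponential.
  set δ' := min (min δ r) (ρ / 2) with hδ'
  have hδ'0 : 0 < δ' := by
    have : (0 : ℝ) < r := hr0
    positivity
  obtain ⟨η₂, hη₂, h₂⟩ := hc δ' hδ'0
  refine ⟨min η₁ η₂, lt_min hη₁ hη₂, fun {G} _ ψ hψ => ?_⟩
  have hexp : ∀ g, NormedSpace.exp (L (ψ g)) = ψ g := fun g =>
    h₁ (by rw [dist_eq_norm]; exact (hψ g).trans_le (min_le_left _ _))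
  have hsm : ∀ g, ‖L (ψ g)‖ < δ' := fun g => h₂ _ ((hψ g).trans_le (min_le_right _ _))
  have hadd : ∀ g h, L (ψ (g * h)) = L (ψ g) + L (ψ h) := by
    intro g h
    have e1 : NormedSpace.exp (L (ψ g) + L (ψ h)) = ψ (g * h) := by
      rw [exp_add_of_norm_lt hr, hexp, hexp, map_mul]
      · exact (hsm g).trans_le ((min_le_left _ _).trans (min_le_right _ _))
      · exact (hsm h).trans_le ((min_le_left _ _).trans (min_le_right _ _))
    rw [← e1]
    refine hρL ?_
    rw [dist_zero_right]
    have e2 : δ' ≤ ρ / 2 := min_le_right _ _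
    linarith [norm_add_le (L (ψ g)) (L (ψ h)), hsm g, hsm h]
  refine ⟨AddMonoidHom.mk' (fun g => L (ψ g.toMul)) (fun g h => hadd _ _), fun g => ?_,
    fun g => hexp g, fun ε hε => ?_⟩
  · exact (hsm _).trans_le ((min_le_left _ _).trans (min_le_left _ _))
  · obtain ⟨η', h1, h2⟩ := hc ε hε
    exact ⟨η', h1, fun g hg => h2 _ hg⟩

end Exp

end PowerSeries

/-! ### The field of `p`-adic complex numbers -/

section Padic

variable (p : ℕ) [Fact p.Prime]

theorem PadicComplex.norm_natCast (n : ℕ) : ‖(n : ℂ_[p])‖ = ‖(n : ℚ_[p])‖ := by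
  rw [← PadicComplex.norm_extends']
  simp

/-- Legendre's formula gives `(p - 1) * v(n!) ≤ n`, hence `v(n!) ≤ n`. -/
theorem PadicComplex.norm_inv_factorial_le (n : ℕ) : ‖((n ! : ℂ_[p]))⁻¹‖ ≤ (p : ℝ) ^ n := by
  have hp : 1 < p := (Fact.out : p.Prime).one_lt
  rw [norm_inv, PadicComplex.norm_natCast, Padic.norm_eq_zpow_neg_valuation
    (by exact_mod_cast n.factorial_ne_zero), Padic.valuation_natCast, zpow_neg, inv_inv,
    zpow_natCast]
  refine pow_le_pow_right₀ (by exact_mod_cast hp.le) ?_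
  have h1 := sub_one_mul_padicValNat_factorial (p := p) n
  calc padicValNat p n ! = 1 * padicValNat p n ! := (one_mul _).symm
    _ ≤ (p - 1) * padicValNat p n ! := Nat.mul_le_mul_right _ (by omega)
    _ ≤ n := h1 ▸ Nat.sub_le _ _

theorem PadicComplex.exists_summable_expSeries :
    ∃ r : ℝ≥0, 0 < r ∧ Summable fun n : ℕ => ‖((n ! : ℂ_[p]))⁻¹‖ * (r : ℝ) ^ n := by
  have hp : (0 : ℝ) < p := by exact_mod_cast (Fact.out : p.Prime).pos
  refine ⟨(2 * p)⁻¹, by have : 0 < (p : ℝ≥0) := by exact_mod_cast hp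
                        positivity, ?_⟩
  refine Summable.of_nonneg_of_le (fun n => by positivity) (fun n => ?_) summable_geometric_two
  refine (mul_le_mul_of_nonneg_right (PadicComplex.norm_inv_factorial_le p n)
    (by positivity)).trans (le_of_eq ?_)
  push_cast
  rw [← mul_pow]
  congr 1
  field_simp

end Padic
end

noncomputable section
open Filter Topology

namespace CharVar

/-! ### Extension of characters to the profinite completion -/

section Extension

variable {p : ℕ} [Fact p.Prime] {Γ : Type u} [CommGroup Γ]

theorem Profin.denseRange_eta : DenseRange (Profin.eta : Γ → Profin Γ) :=
  ProfiniteGrp.ProfiniteCompletion.denseRange (GrpCat.of Γ)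

/-- A homomorphism to a compact totally disconnected group extends to the profinite completion. -/
theorem Profin.exists_extension {G : Type} [CommGroup G] [TopologicalSpace G]
    [IsTopologicalGroup G] [CompactSpace G] [TotallyDisconnectedSpace G] (z : Γ →* G) :
    ∃ χ : Profin Γ →ₜ* G, ∀ γ, χ (Profin.eta γ) = z γ := by
  have _ : TotallyDisconnectedSpace (ULift.{u} G) :=
    Homeomorph.ulift.symm.totallyDisconnectedSpace
  let P : ProfiniteGrp.{u} := ProfiniteGrp.of (ULift.{u} G)
  let f : GrpCat.of Γ ⟶ GrpCat.of P :=
    GrpCat.ofHom ((MulEquiv.ulift (α := G)).symm.toMonoidHom.comp z)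
  let F : Profin Γ →ₜ* ULift.{u} G := (ProfiniteGrp.ProfiniteCompletion.lift f).hom
  refine ⟨⟨(MulEquiv.ulift (α := G)).toMonoidHom.comp F.toMonoidHom,
    continuous_uliftDown.comp F.continuous_toFun⟩, fun γ => ?_⟩
  have h := CategoryTheory.ConcreteCategory.congr_hom (ProfiniteGrp.ProfiniteCompletion.lift_eta f) γ
  exact congrArg ULift.down h

/-- The compact group of units of norm one in a finite-dimensional subfield of `PadicAlgCl p`. -/
def normOneUnits (E : IntermediateField ℚ_[p] (PadicAlgCl p)) : Subgroup (PadicAlgCl p)ˣ where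
  carrier := {u | (u : PadicAlgCl p) ∈ E ∧ ‖(u : PadicAlgCl p)‖ = 1}
  mul_mem' {u v} hu hv := ⟨E.mul_mem hu.1 hv.1, by simp [hu.2, hv.2]⟩
  one_mem' := ⟨E.one_mem, by simp⟩
  inv_mem' {u} hu := ⟨by simpa using E.inv_mem hu.1, by simp [hu.2]⟩

/-- A finite extension of `ℚ_p` is a proper space, so its unit sphere is compact, and inversion is
continuous on it. -/
theorem compactSpace_normOneUnits (E : IntermediateField ℚ_[p] (PadicAlgCl p))
    [FiniteDimensional ℚ_[p] E] : CompactSpace (normOneUnits E) := by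
  have _ : ProperSpace E := FiniteDimensional.proper ℚ_[p] E
  refine isCompact_iff_compactSpace.1 ?_
  have hne : ∀ e : Metric.sphere (0 : E) 1, ((e : E) : PadicAlgCl p) ≠ 0 := by
    intro e he
    have h1 : ‖(e : E)‖ = 1 := by simp
    have h2 : (e : E) = 0 := by exact_mod_cast he
    rw [h2, norm_zero] at h1
    exact zero_ne_one h1
  let f : Metric.sphere (0 : E) 1 → (PadicAlgCl p)ˣ := fun e => Units.mk0 _ (hne e)
  have hval : Continuous fun e : Metric.sphere (0 : E) 1 => ((e : E) : PadicAlgCl p) :=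
    continuous_subtype_val.comp continuous_subtype_val
  have hf : Continuous f := by
    rw [Units.continuous_iff]
    refine ⟨hval, ?_⟩
    change Continuous fun e => (((f e)⁻¹ : (PadicAlgCl p)ˣ) : PadicAlgCl p)
    simp_rw [Units.val_inv_eq_inv_val]
    exact hval.inv₀ hne
  have _ : CompactSpace (Metric.sphere (0 : E) 1) :=
    isCompact_iff_compactSpace.1 (isCompact_sphere _ _)
  have hr : Set.range f = (normOneUnits E : Set (PadicAlgCl p)ˣ) := by
    ext u
    constructor
    · rintro ⟨e, rfl⟩
      exact ⟨(e : E).2, mem_sphere_zero_iff_norm.1 e.2⟩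
    · rintro ⟨h1, h2⟩
      exact ⟨⟨⟨u, h1⟩, by simpa using h2⟩, Units.ext rfl⟩
  rw [← hr]
  exact isCompact_range hf

theorem totallyDisconnectedSpace_units : TotallyDisconnectedSpace (PadicAlgCl p)ˣ :=
  ⟨isTotallyDisconnected_of_image Units.continuous_val.continuousOn Units.val_injective
    (isTotallyDisconnected_of_totallyDisconnectedSpace _)⟩

/-- A character of a finitely generated group with values of norm one extends to a continuous
character of the profinite completion. -/
theorem exists_continuous_extension [Group.FG Γ] (z : Γ →* (PadicAlgCl p)ˣ)
    (hz : ∀ γ, ‖(z γ : PadicAlgCl p)‖ = 1) :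
    ∃ χ : Profin Γ →ₜ* (PadicAlgCl p)ˣ, ∀ γ, χ (Profin.eta γ) = z γ := by
  obtain ⟨_, S, -, hS⟩ := Group.fg_iff'.1 (inferInstance : Group.FG Γ)
  -- The values on finitely many generators span a finite extension, whose norm-one units form a
  -- profinite group to which the universal property applies.
  let E : IntermediateField ℚ_[p] (PadicAlgCl p) :=
    IntermediateField.adjoin ℚ_[p] ((fun γ => (z γ : PadicAlgCl p)) '' S)
  have _ : Finite ((fun γ => (z γ : PadicAlgCl p)) '' (S : Set Γ)) :=
    (S.finite_toSet.image _).to_subtype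
  have _ : FiniteDimensional ℚ_[p] E :=
    IntermediateField.finiteDimensional_adjoin fun x _ => Algebra.IsIntegral.isIntegral x
  have hE : ∀ γ, z γ ∈ normOneUnits E := by
    have h1 : Subgroup.closure (S : Set Γ) ≤ (normOneUnits E).comap z := by
      rw [Subgroup.closure_le]
      intro γ hγ
      exact ⟨IntermediateField.subset_adjoin _ _ ⟨γ, hγ, rfl⟩, hz γ⟩
    intro γ
    exact h1 (hS ▸ Subgroup.mem_top γ)
  have _ := compactSpace_normOneUnits E
  have _ : TotallyDisconnectedSpace (PadicAlgCl p)ˣ := totallyDisconnectedSpace_units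
  obtain ⟨χ, hχ⟩ := Profin.exists_extension (z.codRestrict (normOneUnits E) hE)
  refine ⟨⟨(normOneUnits E).subtype.comp χ.toMonoidHom,
    continuous_subtype_val.comp χ.continuous_toFun⟩, fun γ => ?_⟩
  exact congrArg Subtype.val (hχ γ)

theorem ext_of_eta {G : Type*} [Group G] [TopologicalSpace G] [T2Space G]
    {χ χ' : Profin Γ →ₜ* G}
    (h : ∀ γ, χ (Profin.eta γ) = χ' (Profin.eta γ)) : χ = χ' := by
  refine DFunLike.coe_injective ?_
  exact Profin.denseRange_eta.equalizer χ.continuous_toFun χ'.continuous_toFun (funext h)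

end Extension

/-! ### Residue characters -/

section Residue

variable {p : ℕ} [Fact p.Prime]

theorem norm_eq_one_of_mem_unitGroup {u : (PadicAlgCl p)ˣ} (hu : u ∈ (integers p).unitGroup) :
    ‖(u : PadicAlgCl p)‖ = 1 := by
  have h1 : ∀ v : (PadicAlgCl p)ˣ, v ∈ (integers p).unitGroup → ‖(v : PadicAlgCl p)‖ ≤ 1 := by
    intro v hv
    rw [ValuationSubring.mem_unitGroup_iff] at hv
    have h2 := ((integers p).valuation_le_one_iff _).1 hv.le
    rw [integers, Valuation.mem_valuationSubring_iff, PadicAlgCl.valuation_def] at h2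
    exact_mod_cast h2
  refine le_antisymm (h1 u hu) ?_
  have h3 := h1 u⁻¹ (inv_mem hu)
  rw [Units.val_inv_eq_inv_val, norm_inv] at h3
  exact (inv_le_one₀ (norm_pos_iff.2 u.ne_zero)).1 h3

theorem mem_integers_iff (w : PadicAlgCl p) : w ∈ integers p ↔ ‖w‖ ≤ 1 := by
  rw [integers, Valuation.mem_valuationSubring_iff, PadicAlgCl.valuation_def]
  exact_mod_cast Iff.rfl

theorem residue_eq_iff (v w : integers p) : IsLocalRing.residue (integers p) v =
    IsLocalRing.residue (integers p) w ↔ ‖(v : PadicAlgCl p) - w‖ < 1 := by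
  rw [← sub_eq_zero, ← map_sub, IsLocalRing.residue_eq_zero_iff,
    ValuationSubring.valuation_lt_one_iff]
  have h0 : (integers p).valuation.IsEquiv (Valued.v : Valuation (PadicAlgCl p) NNReal) :=
    (Valuation.isEquiv_valuation_valuationSubring _).symm
  rw [h0.lt_one_iff_lt_one, PadicAlgCl.valuation_def]
  exact_mod_cast Iff.rfl

variable {G : Type u} [Group G] [TopologicalSpace G] [CompactSpace G]

theorem norm_apply_eq_one (χ : G →ₜ* (PadicAlgCl p)ˣ) (g : G) : ‖(χ g : PadicAlgCl p)‖ = 1 :=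
  norm_eq_one_of_mem_unitGroup (mem_unitGroup χ g)

theorem residueChar_val (χ : G →ₜ* (PadicAlgCl p)ˣ) (g : G) :
    ((residueChar χ g : (ResField p)ˣ) : ResField p) = IsLocalRing.residue (integers p)
      ⟨χ g, (mem_integers_iff _).2 (norm_apply_eq_one χ g).le⟩ := rfl

theorem residueChar_eq_iff (χ χ' : G →ₜ* (PadicAlgCl p)ˣ) (g g' : G) :
    residueChar χ g = residueChar χ' g' ↔ ‖(χ g : PadicAlgCl p) - χ' g'‖ < 1 := by
  rw [Units.ext_iff, residueChar_val, residueChar_val, residue_eq_iff]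

theorem isLocallyConstant_residueChar (χ : G →ₜ* (PadicAlgCl p)ˣ) :
    IsLocallyConstant (residueChar χ) := by
  rw [IsLocallyConstant.iff_eventually_eq]
  intro g
  have h1 : Continuous fun g : G => (χ g : PadicAlgCl p) :=
    Units.continuous_val.comp χ.continuous_toFun
  have h2 := Metric.tendsto_nhds.1 (h1.tendsto g) 1 one_pos
  filter_upwards [h2] with g' hg'
  rwa [residueChar_eq_iff, ← dist_eq_norm]

theorem eq_of_eta_of_isLocallyConstant {Γ : Type u} [CommGroup Γ] {Y : Type*}
    {f f' : Profin Γ → Y} (hf : IsLocallyConstant f) (hf' : IsLocallyConstant f')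
    (h : ∀ γ : Γ, f (Profin.eta γ) = f' (Profin.eta γ)) : f = f' := by
  let _ : TopologicalSpace Y := ⊥
  have _ : DiscreteTopology Y := ⟨rfl⟩
  exact Profin.denseRange_eta.equalizer hf.continuous hf'.continuous (funext h)

/-- Roots of unity of the residue field lift to roots of unity. -/
theorem exists_root_of_unity_lift (Q : ℕ) (hQ : 0 < Q) (x : ResField p) (hx : x ^ Q = 1) :
    ∃ w : integers p, w ^ Q = 1 ∧ IsLocalRing.residue (integers p) w = x := by
  obtain ⟨v, rfl⟩ := IsLocalRing.residue_surjective x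
  have hv : ‖(v : PadicAlgCl p) ^ Q - 1‖ < 1 := by
    have := (residue_eq_iff (v ^ Q) 1).1 (by rw [map_pow, hx, map_one])
    exact_mod_cast this
  -- The polynomial `(X + v) ^ Q - 1` has constant term `v ^ Q - 1` of norm below one, hence a root
  -- `y` of norm below one. Then `y + v` is a root of unity congruent to `v`; no separability is
  -- needed.
  obtain ⟨y, hy, hy1⟩ := exists_isRoot_norm_lt
    ((Polynomial.X ^ Q - 1 : Polynomial (PadicAlgCl p)).comp
      (Polynomial.X + Polynomial.C (v : PadicAlgCl p)))
    ((Polynomial.monic_X_pow_sub_C 1 hQ.ne').comp_X_add_C _) 1 one_pos (by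
      rw [one_pow, Polynomial.coeff_zero_eq_eval_zero]
      simpa using hv)
  have hy' : (y + v) ^ Q = 1 := by
    have h1 : Polynomial.eval y _ = 0 := hy
    simpa [sub_eq_zero] using h1
  have hn : ‖y + (v : PadicAlgCl p)‖ = 1 := by
    have := congrArg norm hy'
    rw [norm_pow, norm_one] at this
    exact (pow_eq_one_iff_of_nonneg (norm_nonneg _) hQ.ne').1 this
  refine ⟨⟨y + v, (mem_integers_iff _).2 hn.le⟩, Subtype.ext hy', ?_⟩
  rw [residue_eq_iff]
  simpa using hy1

/-- The Teichmüller lift of a residue character. -/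
theorem exists_teichmuller (ξ : G →* (ResField p)ˣ) (hξ : IsLocallyConstant ξ) :
    ∃ T : G →ₜ* (PadicAlgCl p)ˣ, residueChar T = ξ ∧ (∃ Q, 0 < Q ∧ ∀ g, T g ^ Q = 1) ∧
      ∀ g h, ξ g = ξ h → T g = T h := by
  have _ : Finite ξ.range := hξ.range_finite.to_subtype
  -- The image of `ξ` is a finite subgroup of the units of a field, hence cyclic; lifting a
  -- generator defines `T` as a function of `ξ`.
  obtain ⟨h, hh⟩ := (inferInstance : IsCyclic ξ.range).exists_generator
  have hQ : 0 < orderOf h := orderOf_pos h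
  obtain ⟨w, hw, hwh⟩ := exists_root_of_unity_lift (p := p) (orderOf h) hQ
    ((h : (ResField p)ˣ) : ResField p) (by
      have h1 : (((h ^ orderOf h : ξ.range) : (ResField p)ˣ) : ResField p) = 1 := by
        rw [pow_orderOf_eq_one]
        rfl
      rwa [Subgroup.coe_pow, Units.val_pow_eq_pow_val] at h1)
  have hw' : (w : PadicAlgCl p) ^ orderOf h = 1 := by exact_mod_cast congrArg Subtype.val hw
  let ω : (PadicAlgCl p)ˣ := Units.ofPowEqOne _ _ hw' hQ.ne'
  have hωw : (ω : PadicAlgCl p) = w := rfl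
  have hω : ω ^ orderOf h = 1 := Units.ext (by rw [Units.val_pow_eq_pow_val, hωw, hw', Units.val_one])
  let T₀ : ξ.range →* (PadicAlgCl p)ˣ :=
    monoidHomOfForallMemZpowers hh (orderOf_dvd_of_pow_eq_one hω)
  have hT₀ : T₀ h = ω := monoidHomOfForallMemZpowers_apply_gen hh _
  have hcont : Continuous (T₀.comp ξ.rangeRestrict) := by
    have h1 : IsLocallyConstant ξ.rangeRestrict :=
      IsLocallyConstant.desc ξ.rangeRestrict Subtype.val hξ Subtype.val_injective
    exact (h1.comp T₀).continuous
  have hpow : ∀ g, ∃ n : ℕ, ξ.rangeRestrict g = h ^ n := by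
    intro g
    obtain ⟨n, hn⟩ := (mem_powers_iff_mem_zpowers (x := h)).2 (hh (ξ.rangeRestrict g))
    exact ⟨n, hn.symm⟩
  have hTg : ∀ g n, ξ.rangeRestrict g = h ^ n → (T₀.comp ξ.rangeRestrict) g = ω ^ n := by
    intro g n hn
    rw [MonoidHom.comp_apply, hn, map_pow, hT₀]
  refine ⟨⟨T₀.comp ξ.rangeRestrict, hcont⟩, ?_, ⟨orderOf h, hQ, fun g => ?_⟩, fun g g' hgg => ?_⟩
  · ext g
    obtain ⟨n, hn⟩ := hpow g
    have h1 : (ξ g : (ResField p)ˣ) = (h : (ResField p)ˣ) ^ n := congrArg Subtype.val hn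
    rw [residueChar_val, h1, Units.val_pow_eq_pow_val, ← hwh, ← map_pow]
    congr 1
    refine Subtype.ext ?_
    have h2 := congrArg Units.val (hTg g n hn)
    rw [Units.val_pow_eq_pow_val, hωw] at h2
    exact h2
  · obtain ⟨n, hn⟩ := hpow g
    change (T₀.comp ξ.rangeRestrict) g ^ orderOf h = 1
    rw [hTg g n hn, ← pow_mul, mul_comm, pow_mul, hω, one_pow]
  · change T₀ (ξ.rangeRestrict g) = T₀ (ξ.rangeRestrict g')
    congr 1
    exact Subtype.ext hgg

end Residue

end CharVar
end

noncomputable section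
open Filter Topology

namespace CharVar

/-! ### The map to the pro-`p` completion -/

section ProP

variable {p : ℕ}
variable {G : Type u} [CommGroup G] [TopologicalSpace G]

/-- The projection to a finite quotient. -/
def PQuot.proj (N : PIndex p G) : Additive G →+ PQuot N :=
  MonoidHom.toAdditive (QuotientGroup.mk' N.sub)

theorem PQuot.proj_eq_zero_iff (N : PIndex p G) (g : G) :
    PQuot.proj N (Additive.ofMul g) = 0 ↔ g ∈ N.sub :=
  QuotientGroup.eq_one_iff g

variable [hp : Fact p.Prime]

variable (p G) in
/-- The canonical map from a group to its pro-`p` completion. -/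
def ProP.eta : Additive G →+ ProP p G where
  toFun g := ⟨fun N => PQuot.proj N g, fun _ _ _ => rfl⟩
  map_zero' := rfl
  map_add' _ _ := rfl

/-- `ℚ_p` is the localization of `ℤ_p` at its nonzero elements, so tensoring kills only torsion. -/
theorem ProPRat.exists_smul_eq_zero (x : ProP p G) (hx : (1 : ℚ_[p]) ⊗ₜ[ℤ_[p]] x = 0) :
    ∃ z : ℤ_[p], z ≠ 0 ∧ z • x = 0 := by
  obtain ⟨s, hs⟩ := (IsLocalizedModule.eq_zero_iff (nonZeroDivisors ℤ_[p])
    (TensorProduct.mk ℤ_[p] ℚ_[p] (ProP p G) 1)).1 hx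
  exact ⟨s, nonZeroDivisors.ne_zero s.2, hs⟩

end ProP

section Weights

variable {p : ℕ} [hp : Fact p.Prime] {Γ : Type u} [CommGroup Γ] {Γ₀ : Subgroup Γ}
  {σ : Profin Γ ≃ₜ* Profin Γ} {α : ℤ_[p]ˣ}

/-- The weights of `σ` give a quadratic relation on the pro-`p` completion, up to torsion. -/
theorem HasWeights.exists_smul_eq_zero (h : HasWeights Γ₀ σ α) (g : Profin Γ) :
    ∃ z : ℤ_[p], z ≠ 0 ∧ z • (ProP.eta p (Profin Γ) (Additive.ofMul (σ (σ g)))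
      - (((α⁻¹ : ℤ_[p]ˣ) : ℤ_[p]) + ((α⁻¹ : ℤ_[p]ˣ) : ℤ_[p]) ^ 2) •
          ProP.eta p (Profin Γ) (Additive.ofMul (σ g))
      + (((α⁻¹ : ℤ_[p]ˣ) : ℤ_[p]) ^ 3) • ProP.eta p (Profin Γ) (Additive.ofMul g)) = 0 := by
  set β : ℤ_[p] := ((α⁻¹ : ℤ_[p]ˣ) : ℤ_[p]) with hβ
  set E := inducedEnd p σ with hE
  refine ProPRat.exists_smul_eq_zero _ ?_
  set v : ProPRat p (Profin Γ) := 1 ⊗ₜ ProP.eta p (Profin Γ) (Additive.ofMul g) with hv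
  have hEv : E v = 1 ⊗ₜ ProP.eta p (Profin Γ) (Additive.ofMul (σ g)) := rfl
  have hEEv : E (E v) = 1 ⊗ₜ ProP.eta p (Profin Γ) (Additive.ofMul (σ (σ g))) := rfl
  -- The weight on the quotient puts `E v - β v` in the subspace, where `E` is multiplication by
  -- `β²`. Hence `(E - β²)(E - β) v = 0`.
  have hw : E v - (β : ℚ_[p]) • v ∈ natPart p Γ₀ := by
    have h1 := DFunLike.congr_fun h.on_quotient ((natPart p Γ₀).mkQ v)
    rw [Submodule.mkQ_apply, Submodule.mapQ_apply] at h1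
    rw [← Submodule.Quotient.mk_eq_zero, Submodule.Quotient.mk_sub, sub_eq_zero,
      Submodule.Quotient.mk_smul]
    exact h1
  have hEw : E (E v - (β : ℚ_[p]) • v) = ((β ^ 2 : ℤ_[p]) : ℚ_[p]) • (E v - (β : ℚ_[p]) • v) := by
    have h1 := congrArg Subtype.val (DFunLike.congr_fun h.on_sub ⟨_, hw⟩)
    simpa [hβ] using h1
  have hsm : ∀ (c : ℤ_[p]) (x : ProP p (Profin Γ)),
      (1 : ℚ_[p]) ⊗ₜ[ℤ_[p]] (c • x) = (c : ℚ_[p]) • ((1 : ℚ_[p]) ⊗ₜ[ℤ_[p]] x) := by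
    intro c x
    rw [TensorProduct.tmul_smul]
    exact (algebraMap_smul ℚ_[p] c _).symm
  rw [TensorProduct.tmul_add, TensorProduct.tmul_sub, hsm, hsm, ← hEv, ← hEEv, ← hv]
  rw [map_sub, map_smul, smul_sub, smul_smul, sub_eq_sub_iff_add_eq_add] at hEw
  rw [sub_add_eq_add_sub, sub_eq_zero]
  push_cast at hEw ⊢
  rw [add_smul, add_comm ((β : ℚ_[p]) • E v), ← hEw]
  congr 2
  ring

end Weights

/-! ### Continuous logarithms -/

section Log

variable {p : ℕ} [hp : Fact p.Prime]

variable (p) in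
/-- The embedding of `ℤ_p` into the `p`-adic complex numbers. -/
def intToComplex : ℤ_[p] →+* ℂ_[p] := (algebraMap ℚ_[p] ℂ_[p]).comp PadicInt.Coe.ringHom

theorem norm_intToComplex (z : ℤ_[p]) : ‖intToComplex p z‖ = ‖z‖ := by
  rw [intToComplex, RingHom.comp_apply, norm_algebraMap', PadicInt.norm_def]
  rfl

theorem intToComplex_injective : Function.Injective (intToComplex p) := by
  rw [injective_iff_map_eq_zero]
  intro z hz
  rw [← norm_eq_zero, ← norm_intToComplex, hz, norm_zero]

theorem continuous_intToComplex : Continuous (intToComplex p) :=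
  (AddMonoidHomClass.isometry_of_norm (intToComplex p) norm_intToComplex).continuous

theorem tendsto_appr (z : ℤ_[p]) :
    Tendsto (fun n => (z.appr n : ℂ_[p])) atTop (𝓝 (intToComplex p z)) := by
  have h1 : Tendsto (fun n => (z.appr n : ℤ_[p])) atTop (𝓝 z) := by
    rw [tendsto_iff_norm_sub_tendsto_zero]
    have hp1 : (1 : ℝ) < p := by exact_mod_cast hp.out.one_lt
    refine squeeze_zero (fun _ => norm_nonneg _) (fun n => ?_)
      (tendsto_pow_atTop_nhds_zero_of_lt_one (r := (p : ℝ)⁻¹) (by positivity)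
        (inv_lt_one_of_one_lt₀ hp1))
    rw [norm_sub_rev]
    have h2 := (PadicInt.norm_le_pow_iff_mem_span_pow _ n).2 (PadicInt.appr_spec n z)
    rwa [zpow_neg, zpow_natCast, ← inv_pow] at h2
  have h2 := (continuous_intToComplex.tendsto z).comp h1
  simpa [Function.comp_def] using h2

variable {G : Type u} [CommGroup G] [TopologicalSpace G] [IsTopologicalGroup G] [CompactSpace G]

/-- The open subgroup of `p`-power index on which a continuous logarithm is small. -/
def PIndex.ofLog (l : Additive G →+ ℂ_[p])
    (hl : ∀ ε > 0, ∀ᶠ g : G in 𝓝 1, ‖l (Additive.ofMul g)‖ < ε) (ε : ℝ) (hε : 0 < ε) :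
    PIndex p G := by
  let N : Subgroup G :=
    { carrier := {g | ‖l (Additive.ofMul g)‖ < ε}
      one_mem' := by
        change ‖l 0‖ < ε
        rwa [map_zero, norm_zero]
      mul_mem' := fun {g h} hg hh => by
        change ‖l (Additive.ofMul g + Additive.ofMul h)‖ < ε
        rw [map_add]
        exact (IsUltrametricDist.norm_add_le_max _ _).trans_lt (max_lt hg hh)
      inv_mem' := fun {g} hg => by
        change ‖l (-Additive.ofMul g)‖ < ε
        rwa [map_neg, norm_neg] }
  have hN : IsOpen (N : Set G) := Subgroup.isOpen_of_mem_nhds N (hl ε hε)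
  refine ⟨⟨N, hN⟩, ?_⟩
  have _ : Finite (G ⧸ N) := Subgroup.quotient_finite_of_isOpen N hN
  -- The values `p ^ n * l g` tend to zero, so a `p`-power of every element lies in `N`.
  have hpg : IsPGroup p (G ⧸ N) := by
    intro x
    obtain ⟨g, rfl⟩ := QuotientGroup.mk_surjective x
    have hp1 : (1 : ℝ) < p := by exact_mod_cast hp.out.one_lt
    have h1 : Tendsto (fun n : ℕ => (p : ℝ)⁻¹ ^ n * ‖l (Additive.ofMul g)‖) atTop (𝓝 0) := by
      simpa using (tendsto_pow_atTop_nhds_zero_of_lt_one (r := (p : ℝ)⁻¹) (by positivity)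
        (inv_lt_one_of_one_lt₀ hp1)).mul_const ‖l (Additive.ofMul g)‖
    obtain ⟨n, hn⟩ := (h1.eventually_lt_const hε).exists
    refine ⟨n, ?_⟩
    rw [← QuotientGroup.mk_pow, QuotientGroup.eq_one_iff]
    change ‖l (p ^ n • Additive.ofMul g)‖ < ε
    rw [map_nsmul, nsmul_eq_mul, norm_mul, Nat.cast_pow, norm_pow, PadicComplex.norm_natCast,
      Padic.norm_p]
    exact hn
  exact IsPGroup.iff_card.1 hpg

theorem PIndex.mem_ofLog (l : Additive G →+ ℂ_[p])
    (hl : ∀ ε > 0, ∀ᶠ g : G in 𝓝 1, ‖l (Additive.ofMul g)‖ < ε) (ε : ℝ) (hε : 0 < ε) (g : G) :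
    g ∈ (PIndex.ofLog l hl ε hε).sub ↔ ‖l (Additive.ofMul g)‖ < ε := Iff.rfl

/-- A continuous logarithm respects `ℤ_p`-linear relations in the pro-`p` completion. -/
theorem log_relation (l : Additive G →+ ℂ_[p])
    (hl : ∀ ε > 0, ∀ᶠ g : G in 𝓝 1, ‖l (Additive.ofMul g)‖ < ε) (z a b : ℤ_[p]) (hz : z ≠ 0)
    (g₀ g₁ g₂ : Additive G)
    (h : z • (ProP.eta p G g₂ - a • ProP.eta p G g₁ + b • ProP.eta p G g₀) = 0) :
    l g₂ - intToComplex p a * l g₁ + intToComplex p b * l g₀ = 0 := by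
  set c := l g₂ - intToComplex p a * l g₁ + intToComplex p b * l g₀ with hc
  suffices hzc : intToComplex p z * c = 0 by
    refine (mul_eq_zero.1 hzc).resolve_left fun h0 => hz (intToComplex_injective ?_)
    rw [h0, map_zero]
  -- Replacing `z`, `a`, `b` by natural approximations gives honest group elements. The relation
  -- puts them in `N` for large `n`, so the limit has norm at most `ε`.
  have hlim : Tendsto (fun n => l (z.appr n • (g₂ - a.appr n • g₁ + b.appr n • g₀))) atTop
      (𝓝 (intToComplex p z * c)) := by
    simp only [map_nsmul, map_add, map_sub, nsmul_eq_mul]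
    exact (tendsto_appr z).mul (((tendsto_const_nhds).sub ((tendsto_appr a).mul_const _)).add
      ((tendsto_appr b).mul_const _))
  rw [← norm_le_zero_iff]
  refine le_of_forall_pos_le_add fun ε hε => ?_
  rw [zero_add]
  refine le_of_tendsto hlim.norm ?_
  set N := PIndex.ofLog l hl ε hε with hN
  filter_upwards [eventually_ge_atTop N.exponent] with n hn
  have h1 : z.appr n • (PQuot.proj N g₂ - a.appr n • PQuot.proj N g₁
      + b.appr n • PQuot.proj N g₀) = 0 := by
    have h2 : z • (PQuot.proj N g₂ - a • PQuot.proj N g₁ + b • PQuot.proj N g₀) = 0 :=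
      congrFun (congrArg Subtype.val h) N
    rwa [PQuot.smul_eq_appr N z _ n hn, PQuot.smul_eq_appr N a _ n hn,
      PQuot.smul_eq_appr N b _ n hn] at h2
  have h3 : PQuot.proj N (z.appr n • (g₂ - a.appr n • g₁ + b.appr n • g₀)) = 0 := by
    rw [← h1, map_nsmul, map_add, map_sub, map_nsmul, map_nsmul]
  exact ((PIndex.mem_ofLog l hl ε hε _).1 ((PQuot.proj_eq_zero_iff N _).1 h3)).le

end Log

/-- A sequence of iterates satisfying a quadratic relation decomposes into eigenvectors. -/
theorem exists_eigen_decomposition {K X : Type*} [NormedField K] [IsUltrametricDist K]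
    (s : X → X) (l : X → K) (b : K) (hb0 : ‖b‖ = 1) (hb : b ^ 2 - b ≠ 0)
    (h : ∀ g, l (s (s g)) - (b + b ^ 2) * l (s g) + b ^ 3 * l g = 0) {δ : ℝ}
    (hδ : ∀ g, ‖l g‖ ≤ δ) : ∃ l₁ l₂ : X → K, (∀ g, ‖l₁ g‖ ≤ δ / ‖b ^ 2 - b‖) ∧
      (∀ g, ‖l₂ g‖ ≤ δ / ‖b ^ 2 - b‖) ∧
      ∀ n g, l (s^[n] g) = b ^ n * l₁ g + (b ^ n) ^ 2 * l₂ g := by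
  have hbound : ∀ (c : K) (g : X), ‖c‖ = 1 →
      ‖(l (s g) - c * l g) / (b ^ 2 - b)‖ ≤ δ / ‖b ^ 2 - b‖ := by
    intro c g hc
    rw [norm_div]
    gcongr
    rw [sub_eq_add_neg]
    refine (IsUltrametricDist.norm_add_le_max _ _).trans (max_le (hδ _) ?_)
    rw [norm_neg, norm_mul, hc, one_mul]
    exact hδ g
  -- These solve `l = l₁ + l₂` and `l ∘ s = b l₁ + b² l₂`, a system of determinant `b² - b`.
  refine ⟨fun g => -((l (s g) - b ^ 2 * l g) / (b ^ 2 - b)),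
    fun g => (l (s g) - b * l g) / (b ^ 2 - b), fun g => ?_, fun g => hbound b g hb0, fun n => ?_⟩
  · rw [norm_neg]
    exact hbound _ g (by rw [norm_pow, hb0, one_pow])
  · induction n with
    | zero =>
      intro g
      simp only [Function.iterate_zero, id_eq, pow_zero, div_eq_mul_inv]
      linear_combination -(l g) * mul_inv_cancel₀ hb
    | succ n ih =>
      intro g
      rw [Function.iterate_succ_apply, ih (s g)]
      have h1 : l (s (s g)) = (b + b ^ 2) * l (s g) - b ^ 3 * l g := by linear_combination h g
      simp only [h1]
      ring

end CharVar
end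

noncomputable section
open Filter Topology
open scoped Nat NNReal

namespace CharVar

/-! ### Powers of characters close to the trivial one -/

section Powers

variable {p : ℕ} [hp : Fact p.Prime]

theorem norm_pow_sub_one_le_norm_sub_one {K : Type*} [NormedField K] [IsUltrametricDist K] {v : K}
    (hv : ‖v‖ ≤ 1) (n : ℕ) : ‖v ^ n - 1‖ ≤ ‖v - 1‖ := by
  rw [← mul_geom_sum, norm_mul]
  refine mul_le_of_le_one_right (norm_nonneg _) ?_
  refine IsUltrametricDist.norm_sum_le_of_forall_le_of_nonneg zero_le_one fun i _ => ?_
  rw [norm_pow]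
  exact pow_le_one₀ (norm_nonneg _) hv

/-- The cofactor of `v - 1` in `v ^ p - 1` is `∑ (v ^ i - 1) + p`, and every term has norm at most
`ρ`. Raising to the `p`-th power thus contracts towards `1`. -/
theorem norm_pow_prime_sub_one_le {v : ℂ_[p]} (hv : ‖v‖ ≤ 1) {ρ : ℝ} (hρ : (p : ℝ)⁻¹ ≤ ρ)
    (h : ‖v - 1‖ ≤ ρ) : ‖v ^ p - 1‖ ≤ ρ * ‖v - 1‖ := by
  rw [← mul_geom_sum, norm_mul, mul_comm]
  gcongr
  have h1 : ∑ i ∈ Finset.range p, v ^ i = ∑ i ∈ Finset.range p, (v ^ i - 1) + (p : ℂ_[p]) := by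
    simp
  rw [h1]
  refine (IsUltrametricDist.norm_add_le_max _ _).trans (max_le ?_ ?_)
  · refine IsUltrametricDist.norm_sum_le_of_forall_le_of_nonneg ((norm_nonneg _).trans h) ?_
    exact fun i _ => (norm_pow_sub_one_le_norm_sub_one hv i).trans h
  · rwa [PadicComplex.norm_natCast, Padic.norm_p]

theorem norm_pow_prime_pow_sub_one_le {v : ℂ_[p]} (hv : ‖v‖ ≤ 1) {ρ : ℝ} (hρ : (p : ℝ)⁻¹ ≤ ρ)
    (hρ1 : ρ ≤ 1) (h : ‖v - 1‖ ≤ ρ) (M : ℕ) : ‖v ^ p ^ M - 1‖ ≤ ρ ^ M * ρ := by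
  have hρ0 : 0 ≤ ρ := (norm_nonneg _).trans h
  induction M with
  | zero => simpa using h
  | succ M ih =>
    rw [pow_succ, pow_mul]
    refine (norm_pow_prime_sub_one_le (by rw [norm_pow]; exact pow_le_one₀ (norm_nonneg _) hv) hρ
      (ih.trans (mul_le_of_le_one_left hρ0 (pow_le_one₀ hρ0 hρ1)))).trans ?_
    rw [pow_succ, mul_comm (ρ ^ M), mul_assoc]
    gcongr

end Powers

/-! ### Interpolation of the orbit of a character -/

section Orbit

variable {p : ℕ} [hp : Fact p.Prime] {Γ : Type u} [CommGroup Γ] {Γ₀ : Subgroup Γ}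
  {σ : Profin Γ ≃ₜ* Profin Γ} {α : ℤ_[p]ˣ}

theorem norm_inv_unit {b : ℤ_[p]} (hb : b = (α⁻¹ : ℤ_[p]ˣ)) : ‖b‖ = 1 := by
  rw [hb]
  exact PadicInt.isUnit_iff.1 (Units.isUnit _)

theorem HasWeights.sq_sub_self_ne_zero (h : HasWeights Γ₀ σ α) {b : ℤ_[p]}
    (hb : b = (α⁻¹ : ℤ_[p]ˣ)) : b ^ 2 - b ≠ 0 := by
  have hb1 := norm_inv_unit hb
  intro h0
  have h1 : b * (b - 1) = 0 := by linear_combination h0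
  rcases mul_eq_zero.1 h1 with h2 | h2
  · rw [h2, norm_zero] at hb1
    exact zero_ne_one hb1
  · refine h.not_root_of_unity ?_
    have h3 : α⁻¹ = 1 := Units.ext (by rw [← hb, Units.val_one]; exact sub_eq_zero.1 h2)
    rw [← inv_inv α, h3, inv_one]
    exact IsOfFinOrder.one

/-- A continuous logarithm on the profinite completion decomposes into eigenvectors of `σ`. -/
theorem HasWeights.exists_log_decomposition (h : HasWeights Γ₀ σ α)
    (l : Additive (Profin Γ) →+ ℂ_[p])
    (hl : ∀ ε > 0, ∀ᶠ g : Profin Γ in 𝓝 1, ‖l (Additive.ofMul g)‖ < ε)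
    {δ : ℝ} (hδ : ∀ g, ‖l g‖ ≤ δ) (b : ℤ_[p]) (hb : b = (α⁻¹ : ℤ_[p]ˣ)) :
    ∃ l₁ l₂ : Profin Γ → ℂ_[p], (∀ g, ‖l₁ g‖ ≤ δ / ‖intToComplex p (b ^ 2 - b)‖) ∧
      (∀ g, ‖l₂ g‖ ≤ δ / ‖intToComplex p (b ^ 2 - b)‖) ∧
      ∀ n g, l (Additive.ofMul (σ^[n] g)) =
        intToComplex p b ^ n * l₁ g + (intToComplex p b ^ n) ^ 2 * l₂ g := by
  have hb1 := norm_inv_unit hb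
  have hne := h.sq_sub_self_ne_zero hb
  have key := exists_eigen_decomposition (K := ℂ_[p]) (fun g => σ g)
    (fun g => l (Additive.ofMul g)) (intToComplex p b) (by rw [norm_intToComplex, hb1])
    (by
      rw [← map_pow, ← map_sub]
      exact (map_ne_zero_iff _ intToComplex_injective).2 hne)
    (fun g => by
      obtain ⟨z, hz, hrel⟩ := h.exists_smul_eq_zero g
      have := log_relation l hl z _ _ hz _ _ _ hrel
      rw [← hb] at this
      simpa using this) (fun g => hδ _)
  simpa using key

/-- For characters with the same residue character, a power of their ratio is uniformly small. -/
theorem exists_pow_ratio_close (x T : Profin Γ →ₜ* (PadicAlgCl p)ˣ)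
    (hxT : residueChar x = residueChar T) {η : ℝ} (hη : 0 < η) :
    ∃ M : ℕ, ∀ g, ‖((((x g / T g) ^ p ^ M : (PadicAlgCl p)ˣ) : PadicAlgCl p) : ℂ_[p]) - 1‖ < η := by
  have hnorm : ∀ g, ‖((x g / T g : (PadicAlgCl p)ˣ) : PadicAlgCl p)‖ = 1 := by
    intro g
    rw [Units.val_div_eq_div_val, norm_div, norm_apply_eq_one, norm_apply_eq_one, div_one]
  have hlt : ∀ g, ‖((x g / T g : (PadicAlgCl p)ˣ) : PadicAlgCl p) - 1‖ < 1 := by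
    intro g
    have h1 := (residueChar_eq_iff x T g g).1 (by rw [hxT])
    rw [Units.val_div_eq_div_val, div_sub_one (Units.ne_zero _), norm_div, norm_apply_eq_one T,
      div_one]
    exact h1
  have hcont : Continuous fun g => ‖((x g / T g : (PadicAlgCl p)ˣ) : PadicAlgCl p) - 1‖ :=
    ((Units.continuous_val.comp (x.continuous_toFun.div' T.continuous_toFun)).sub
      continuous_const).norm
  -- Compactness turns the pointwise bound `< 1` into a uniform `ρ < 1`, which gives an exponent `M`
  -- independent of `g`.
  obtain ⟨g₀, -, hg₀⟩ := isCompact_univ.exists_isMaxOn (Set.univ_nonempty (α := Profin Γ))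
    hcont.continuousOn
  have hp1 : (1 : ℝ) < p := by exact_mod_cast hp.out.one_lt
  set ρ := max (p : ℝ)⁻¹ ‖((x g₀ / T g₀ : (PadicAlgCl p)ˣ) : PadicAlgCl p) - 1‖ with hρ
  have hρ1 : ρ < 1 := max_lt (inv_lt_one_of_one_lt₀ hp1) (hlt g₀)
  have hρ0 : 0 ≤ ρ := le_max_of_le_right (norm_nonneg _)
  have hlim : Tendsto (fun M : ℕ => ρ ^ M * ρ) atTop (𝓝 0) := by
    simpa using (tendsto_pow_atTop_nhds_zero_of_lt_one hρ0 hρ1).mul_const ρ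
  obtain ⟨M, hM⟩ := (hlim.eventually_lt_const hη).exists
  refine ⟨M, fun g => lt_of_le_of_lt ?_ hM⟩
  have hcoe : ((((x g / T g) ^ p ^ M : (PadicAlgCl p)ˣ) : PadicAlgCl p) : ℂ_[p]) =
      ((((x g / T g) : (PadicAlgCl p)ˣ) : PadicAlgCl p) : ℂ_[p]) ^ p ^ M := by
    rw [Units.val_pow_eq_pow_val, PadicComplex.coe_eq, map_pow, PadicComplex.coe_eq]
  rw [hcoe]
  refine norm_pow_prime_pow_sub_one_le ?_ (le_max_left _ _) hρ1.le ?_ M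
  · rw [PadicComplex.norm_extends, hnorm]
  · have h1 : ((((x g / T g) : (PadicAlgCl p)ˣ) : PadicAlgCl p) : ℂ_[p]) - 1 =
        ((((x g / T g : (PadicAlgCl p)ˣ) : PadicAlgCl p) - 1 : PadicAlgCl p) : ℂ_[p]) := by
      rw [PadicComplex.coe_eq, PadicComplex.coe_eq, map_sub, map_one]
    rw [h1, PadicComplex.norm_extends]
    exact (hg₀ (Set.mem_univ g)).trans (le_max_right _ _)

/-- A suitable power of the orbit of a character under `σ` is interpolated by exponentials. -/
theorem HasWeights.exists_interpolation (h : HasWeights Γ₀ σ α)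
    (x T : Profin Γ →ₜ* (PadicAlgCl p)ˣ) (hxT : residueChar x = residueChar T)
    (hT : ∀ g, T (σ g) = T g) (b : ℤ_[p]) (hb : b = (α⁻¹ : ℤ_[p]ˣ)) {δ : ℝ} (hδ : 0 < δ) :
    ∃ (M : ℕ) (l₁ l₂ : Profin Γ → ℂ_[p]), (∀ g, ‖l₁ g‖ ≤ δ) ∧ (∀ g, ‖l₂ g‖ ≤ δ) ∧
      ∀ n g, (((x (σ^[n] g) ^ p ^ M : (PadicAlgCl p)ˣ) : PadicAlgCl p) : ℂ_[p]) =
        ((T g ^ p ^ M : (PadicAlgCl p)ˣ) : PadicAlgCl p) *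
          NormedSpace.exp (intToComplex p b ^ n * l₁ g + (intToComplex p b ^ n) ^ 2 * l₂ g) := by
  obtain ⟨r, hr0, hr⟩ := PadicComplex.exists_summable_expSeries p
  set D := ‖intToComplex p (b ^ 2 - b)‖ with hD
  have hD0 : 0 < D := by
    rw [hD, norm_intToComplex, norm_pos_iff]
    exact h.sq_sub_self_ne_zero hb
  -- Splitting into eigenvectors divides by `b² - b`, of norm `D`; asking for logarithms below `δ *
  -- D` leaves the bound `δ`.
  obtain ⟨η, hη, hlog⟩ := exists_log_character.{u} hr hr0 (mul_pos hδ hD0)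
  obtain ⟨M, hM⟩ := exists_pow_ratio_close x T hxT hη
  let ψ : Profin Γ →* ℂ_[p] :=
    (algebraMap (PadicAlgCl p) ℂ_[p]).toMonoidHom.comp ((Units.coeHom (PadicAlgCl p)).comp
      ((powMonoidHom (p ^ M)).comp (x.toMonoidHom / T.toMonoidHom)))
  have hψ : ∀ g, ψ g = ((((x g / T g) ^ p ^ M : (PadicAlgCl p)ˣ) : PadicAlgCl p) : ℂ_[p]) :=
    fun g => rfl
  have hψc : Continuous ψ := by
    have h1 : Continuous fun g => (((x g / T g) ^ p ^ M : (PadicAlgCl p)ˣ) : PadicAlgCl p) :=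
      Units.continuous_val.comp ((x.continuous_toFun.div' T.continuous_toFun).pow _)
    exact (UniformSpace.Completion.continuous_coe _).comp h1
  obtain ⟨l, hlδ, hlexp, hlc⟩ := hlog ψ hM
  have hl : ∀ ε > 0, ∀ᶠ g : Profin Γ in 𝓝 1, ‖l (Additive.ofMul g)‖ < ε := by
    intro ε hε
    obtain ⟨η', hη', h1⟩ := hlc ε hε
    have h2 := Metric.tendsto_nhds.1 (hψc.tendsto 1) η' hη'
    filter_upwards [h2] with g hg
    rw [map_one, dist_eq_norm] at hg
    exact h1 g hg
  obtain ⟨l₁, l₂, hl₁, hl₂, hdec⟩ := h.exists_log_decomposition l hl (fun g => (hlδ g).le) b hb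
  have hδD : δ * D / D ≤ δ := (mul_div_cancel_right₀ _ hD0.ne').le
  refine ⟨M, l₁, l₂, fun g => (hl₁ g).trans hδD, fun g => (hl₂ g).trans hδD, fun n g => ?_⟩
  have hTn : ∀ n g, T (σ^[n] g) = T g := by
    intro n
    induction n with
    | zero => exact fun g => rfl
    | succ n ih =>
      intro g
      rw [Function.iterate_succ_apply, ih, hT]
  rw [← hdec, hlexp, hψ, hTn, div_pow, PadicComplex.coe_eq, PadicComplex.coe_eq,
    PadicComplex.coe_eq, ← map_mul, ← Units.val_mul, mul_div_cancel]

/-- If a finite combination of the interpolated powers of the orbit vanishes infinitely often, then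
it vanishes at the limit point of the interpolation. -/
theorem sum_eq_zero_of_interpolation {ι : Type*} (s : Finset ι) {r : ℝ≥0}
    (hr : Summable fun n : ℕ => ‖((n ! : ℂ_[p]))⁻¹‖ * (r : ℝ) ^ n) (c l₁ l₂ : ι → ℂ_[p])
    (h₁ : ∀ i ∈ s, ‖l₁ i‖ * 3 ^ 2 < r) (h₂ : ∀ i ∈ s, ‖l₂ i‖ * 3 ^ 2 < r) (b : ℤ_[p])
    {Z : Set ℕ} (hZ : Z.Infinite) (hb : Function.Injective fun n : ℕ => b ^ n)
    (h : ∀ n ∈ Z, ∑ i ∈ s, c i *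
      NormedSpace.exp (intToComplex p b ^ n * l₁ i + (intToComplex p b ^ n) ^ 2 * l₂ i) = 0) :
    ∑ i ∈ s, c i = 0 := by
  have hF : IsPowerSeriesSum (fun t : ℂ_[p] => ∑ i ∈ s, c i *
      ((fun t : ℂ_[p] => NormedSpace.exp (t * l₁ i)) *
        (fun t : ℂ_[p] => NormedSpace.exp (t ^ 2 * l₂ i))) t) ((3 : ℝ≥0) : ℝ) := by
    refine IsPowerSeriesSum.sum _ _ (by positivity) fun i hi => ?_
    refine IsPowerSeriesSum.const_mul _ (IsPowerSeriesSum.mul ?_ ?_ (by positivity))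
    · refine isPowerSeriesSum_exp_mul hr (by positivity) _ ?_
      have h3 := h₁ i hi
      have h4 := norm_nonneg (l₁ i)
      push_cast
      nlinarith
    · refine isPowerSeriesSum_exp_sq_mul hr (by positivity) _ ?_
      exact_mod_cast h₂ i hi
  -- The radius `3` exceeds the required `2`. The zeros `b ^ n` are distinct and lie in the compact
  -- image of `ℤ_p`.
  have hF0 := hF.apply_zero_eq_zero (by norm_num : (2 : ℝ≥0) < 3)
    (C := Set.range (intToComplex p)) (isCompact_range continuous_intToComplex)
    (by
      rintro _ ⟨z, rfl⟩
      rw [norm_intToComplex]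
      exact z.norm_le_one)
    (Z := (fun n : ℕ => intToComplex p (b ^ n)) '' Z)
    (hZ.image (intToComplex_injective.comp hb).injOn)
    (by
      rintro _ ⟨n, -, rfl⟩
      exact ⟨_, rfl⟩)
    (by
      rintro _ ⟨n, hn, rfl⟩
      rw [← h n hn]
      refine Finset.sum_congr rfl fun i hi => ?_
      have hbn : ‖intToComplex p (b ^ n)‖ ≤ 1 := by
        rw [norm_intToComplex]
        exact PadicInt.norm_le_one _
      have hlt : ∀ (u v : ℂ_[p]), ‖u‖ ≤ 1 → ‖v‖ * 3 ^ 2 < r → ‖u * v‖ < r := by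
        intro u v hu hv
        rw [norm_mul]
        have h4 := norm_nonneg v
        have h5 := mul_le_of_le_one_left h4 hu
        linarith
      simp only [← map_pow (intToComplex p) b n, Pi.mul_apply]
      rw [← exp_add_of_norm_lt hr]
      · exact hlt _ _ hbn (h₁ i hi)
      · refine hlt _ _ ?_ (h₂ i hi)
        rw [norm_pow]
        exact pow_le_one₀ (norm_nonneg _) hbn)
  simpa [NormedSpace.exp_zero] using hF0

/-- The orbit of a continuous character under `σ` is recurrent. -/
theorem exists_recurrence [Group.FG Γ] (x : Profin Γ →ₜ* (PadicAlgCl p)ˣ) {ε : ℝ} (hε : 0 < ε) :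
    ∃ m : ℕ, 0 < m ∧ ∀ k g, ‖(x (σ^[m * k] g) : PadicAlgCl p) - x g‖ < ε := by
  let N : Subgroup (Profin Γ) :=
    { carrier := {g | ‖(x g : PadicAlgCl p) - 1‖ < ε}
      one_mem' := by
        change ‖((x 1 : (PadicAlgCl p)ˣ) : PadicAlgCl p) - 1‖ < ε
        rwa [map_one, Units.val_one, sub_self, norm_zero]
      mul_mem' := fun {g h} hg hh => by
        change ‖((x (g * h) : (PadicAlgCl p)ˣ) : PadicAlgCl p) - 1‖ < ε
        have h1 : ((x (g * h) : (PadicAlgCl p)ˣ) : PadicAlgCl p) - 1 =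
            x g * ((x h : PadicAlgCl p) - 1) + ((x g : PadicAlgCl p) - 1) := by
          rw [map_mul, Units.val_mul]
          ring
        rw [h1]
        refine (IsUltrametricDist.norm_add_le_max _ _).trans_lt (max_lt ?_ hg)
        rw [norm_mul, norm_apply_eq_one, one_mul]
        exact hh
      inv_mem' := fun {g} hg => by
        change ‖((x g⁻¹ : (PadicAlgCl p)ˣ) : PadicAlgCl p) - 1‖ < ε
        have h1 : ((x g⁻¹ : (PadicAlgCl p)ˣ) : PadicAlgCl p) - 1 =
            -(x g⁻¹ * ((x g : PadicAlgCl p) - 1)) := by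
          rw [mul_sub, ← Units.val_mul, ← map_mul, inv_mul_cancel, map_one, Units.val_one]
          ring
        rw [h1, norm_neg, norm_mul, norm_apply_eq_one, one_mul]
        exact hg }
  have hN : IsOpen (N : Set (Profin Γ)) :=
    isOpen_lt ((Units.continuous_val.comp x.continuous_toFun).sub continuous_const).norm
      continuous_const
  have _ : Finite (Profin Γ ⧸ N) := Subgroup.quotient_finite_of_isOpen N hN
  obtain ⟨_, S, -, hS⟩ := Group.fg_iff'.1 (inferInstance : Group.FG Γ)
  have hσc : ∀ n, Continuous (σ^[n]) := fun n => σ.continuous_toFun.iterate n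
  have hσm : ∀ n (g h : Profin Γ), σ^[n] (g * h) = σ^[n] g * σ^[n] h := fun n => iterate_map_mul σ n
  -- Pigeonhole: modulo `N` there are finitely many possible images of the generators, so two
  -- iterates of `σ` agree there, and by density everywhere.
  obtain ⟨i, j, hij, heq⟩ : ∃ i j : ℕ, i < j ∧
      (fun s : S => (QuotientGroup.mk (σ^[i] (Profin.eta s.1)) : Profin Γ ⧸ N)) =
        fun s : S => (QuotientGroup.mk (σ^[j] (Profin.eta s.1)) : Profin Γ ⧸ N) := by
    obtain ⟨i, j, hne, he⟩ := Finite.exists_ne_map_eq_of_infinite fun (i : ℕ) (s : S) =>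
      (QuotientGroup.mk (σ^[i] (Profin.eta s.1)) : Profin Γ ⧸ N)
    rcases lt_or_gt_of_ne hne with hlt | hlt
    · exact ⟨i, j, hlt, he⟩
    · exact ⟨j, i, hlt, he.symm⟩
  have hΓ : ∀ γ : Γ, (σ^[i] (Profin.eta γ))⁻¹ * σ^[j] (Profin.eta γ) ∈ N := by
    let d : Γ →* Profin Γ ⧸ N := (QuotientGroup.mk' N).comp
      ((MonoidHom.mk' (σ^[i]) (hσm i)).comp Profin.eta)
    let d' : Γ →* Profin Γ ⧸ N := (QuotientGroup.mk' N).comp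
      ((MonoidHom.mk' (σ^[j]) (hσm j)).comp Profin.eta)
    have hdd : d = d' := MonoidHom.eq_of_eqOn_dense hS fun s hs => congrFun heq ⟨s, hs⟩
    exact fun γ => QuotientGroup.eq.1 (DFunLike.congr_fun hdd γ)
  have hall : ∀ g : Profin Γ, (σ^[i] g)⁻¹ * σ^[j] g ∈ N := by
    have hclosed : IsClosed {g : Profin Γ | (σ^[i] g)⁻¹ * σ^[j] g ∈ N} :=
      (N.isClosed_of_isOpen hN).preimage ((hσc i).inv.mul (hσc j))
    intro g
    exact Profin.denseRange_eta.induction_on g hclosed hΓ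
  -- Surjectivity of `σ^[i]` cancels the common iterate. The statement holds for all `g`, so it
  -- telescopes to multiples of `j - i` although `N` need not be `σ`-stable.
  have hstep : ∀ g : Profin Γ, g⁻¹ * σ^[j - i] g ∈ N := by
    intro g
    obtain ⟨g', rfl⟩ := (σ.surjective.iterate i) g
    have := hall g'
    rwa [← Function.iterate_add_apply, Nat.sub_add_cancel hij.le]
  refine ⟨j - i, Nat.sub_pos_of_lt hij, fun k => ?_⟩
  have hiter : ∀ g, g⁻¹ * σ^[(j - i) * k] g ∈ N := by
    induction k with
    | zero => exact fun g => by simp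
    | succ k ih =>
      intro g
      rw [Nat.mul_succ, Function.iterate_add_apply]
      have h1 := N.mul_mem (hstep g) (ih (σ^[j - i] g))
      rwa [mul_assoc, mul_inv_cancel_left] at h1
  intro g
  have h1 : ‖((x (g⁻¹ * σ^[(j - i) * k] g) : (PadicAlgCl p)ˣ) : PadicAlgCl p) - 1‖ < ε := hiter g
  have h2 : (x (σ^[(j - i) * k] g) : PadicAlgCl p) - x g =
      x g * (((x (g⁻¹ * σ^[(j - i) * k] g) : (PadicAlgCl p)ˣ) : PadicAlgCl p) - 1) := by
    rw [mul_sub, ← Units.val_mul, ← map_mul, mul_inv_cancel_left, mul_one]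
  rwa [h2, norm_mul, norm_apply_eq_one, one_mul]

end Orbit

end CharVar
end

noncomputable section
open Filter Topology
open scoped Nat NNReal

/-! ### Irreducible components of closed subsets of a Noetherian spectrum -/

/-- A component of a closed subset of a Noetherian spectrum is the zero locus of a prime ideal, and
there is a function outside that ideal vanishing on the rest of the closed subset. -/
theorem CharVar.IsComponentOf.exists_prime {R : Type*} [CommRing R] [IsNoetherianRing R]
    {S S' : Set (PrimeSpectrum R)} (hS : IsClosed S) (h : CharVar.IsComponentOf S' S) :
    S' ⊆ S ∧ ∃ (P : Ideal R) (g : R), P.IsPrime ∧ (∀ x, x ∈ S' ↔ P ≤ x.asIdeal) ∧ g ∉ P ∧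
      ∀ x ∈ S, g ∉ x.asIdeal → x ∈ S' := by
  obtain ⟨Z, hZ, rfl⟩ := h
  refine ⟨by rintro _ ⟨x, -, rfl⟩; exact x.2, ?_⟩
  have hirr : IsIrreducible (Subtype.val '' Z) :=
    hZ.1.image _ continuous_subtype_val.continuousOn
  have hcl : IsClosed (Subtype.val '' Z) :=
    hS.isClosedEmbedding_subtypeVal.isClosedMap _ (isClosed_of_mem_irreducibleComponents Z hZ)
  set P := PrimeSpectrum.vanishingIdeal (Subtype.val '' Z) with hP
  have hmem : ∀ x, x ∈ Subtype.val '' Z ↔ P ≤ x.asIdeal := by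
    intro x
    rw [← SetLike.coe_subset_coe, ← PrimeSpectrum.mem_zeroLocus, hP,
      PrimeSpectrum.zeroLocus_vanishingIdeal_eq_closure, hcl.closure_eq]
  -- In a Noetherian space a component contains a nonempty open subset of `S`; shrinking it to a
  -- basic open set yields `g`.
  obtain ⟨U, hU, hUne, hUZ⟩ :=
    TopologicalSpace.NoetherianSpace.exists_isOpen_nonempty_subset_irreducibleComponent Z hZ
  obtain ⟨V, hV, rfl⟩ := isOpen_induced_iff.1 hU
  obtain ⟨q, hq⟩ := hUne
  obtain ⟨_, ⟨g, rfl⟩, hgq, hgV⟩ :=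
    PrimeSpectrum.isTopologicalBasis_basic_opens.exists_subset_of_mem_open hq hV
  refine ⟨P, g, PrimeSpectrum.isIrreducible_iff_vanishingIdeal_isPrime.1 hirr, hmem, ?_, ?_⟩
  · exact fun hg => hgq ((hmem q).1 ⟨q, hUZ hq, rfl⟩ hg)
  · exact fun x hx hgx => ⟨⟨x, hx⟩, hUZ (hgV hgx), rfl⟩

namespace CharVar

/-! ### Evaluation at characters -/

section Eval

variable {K : Type*} [Field K] {Γ : Type u} [CommGroup Γ]

/-- Evaluation of functions on the character variety at a character. -/
def evalAt (w : Γ →* Kˣ) : MonoidAlgebra K Γ →ₐ[K] K :=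
  MonoidAlgebra.lift K K Γ ((Units.coeHom K).comp w)

theorem mem_pointOf (w : Γ →* Kˣ) (f : MonoidAlgebra K Γ) :
    f ∈ (pointOf w).asIdeal ↔ evalAt w f = 0 := Iff.rfl

theorem evalAt_of (w : Γ →* Kˣ) (γ : Γ) : evalAt w (MonoidAlgebra.of K Γ γ) = w γ :=
  MonoidAlgebra.lift_of _ _

theorem evalAt_apply (w : Γ →* Kˣ) (f : MonoidAlgebra K Γ) :
    evalAt w f = ∑ γ ∈ f.coeff.support, f.coeff γ * w γ :=
  MonoidAlgebra.lift_apply _ _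

/-- An algebra homomorphism to the ground field is evaluation at a character. -/
theorem exists_eq_evalAt (F : MonoidAlgebra K Γ →ₐ[K] K) : ∃ w : Γ →* Kˣ, evalAt w = F := by
  refine ⟨((F : MonoidAlgebra K Γ →* K).comp (MonoidAlgebra.of K Γ)).toHomUnits, ?_⟩
  exact MonoidAlgebra.algHom_ext (fun γ => evalAt_of _ γ) (Subsingleton.elim _ _)

/-- The endomorphism of the character variety raising characters to the power `n`. -/
def powMap (K : Type*) [Field K] (Γ : Type u) [CommGroup Γ] (n : ℕ) :
    MonoidAlgebra K Γ →ₐ[K] MonoidAlgebra K Γ :=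
  MonoidAlgebra.lift K (MonoidAlgebra K Γ) Γ ((MonoidAlgebra.of K Γ).comp (powMonoidHom n))

theorem powMap_of (n : ℕ) (γ : Γ) :
    powMap K Γ n (MonoidAlgebra.of K Γ γ) = MonoidAlgebra.of K Γ γ ^ n := by
  rw [powMap, MonoidAlgebra.lift_of, MonoidHom.comp_apply, powMonoidHom_apply, map_pow]

theorem evalAt_powMap (w : Γ →* Kˣ) (n : ℕ) (f : MonoidAlgebra K Γ) :
    evalAt w (powMap K Γ n f) = ∑ γ ∈ f.coeff.support, f.coeff γ * ((w γ ^ n : Kˣ) : K) := by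
  have h : (evalAt w).comp (powMap K Γ n) = evalAt ((powMonoidHom n).comp w) := by
    refine MonoidAlgebra.algHom_ext (fun γ => ?_) (Subsingleton.elim _ _)
    change evalAt w (powMap K Γ n (MonoidAlgebra.of K Γ γ)) = evalAt _ (MonoidAlgebra.of K Γ γ)
    rw [powMap_of, map_pow, evalAt_of, evalAt_of]
    simp
  rw [← AlgHom.comp_apply, h, evalAt_apply]
  rfl

/-- Each `γ` is a root of `X ^ n - γ`, with coefficients acting through the power map, and the `γ`
span. -/
theorem powMap_isIntegral {n : ℕ} (hn : 0 < n) :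
    (powMap K Γ n : MonoidAlgebra K Γ →+* MonoidAlgebra K Γ).IsIntegral := by
  intro f
  induction f using MonoidAlgebra.induction_on with
  | of γ =>
    refine ⟨Polynomial.X ^ n - Polynomial.C (MonoidAlgebra.of K Γ γ),
      Polynomial.monic_X_pow_sub_C _ hn.ne', ?_⟩
    rw [Polynomial.eval₂_sub, Polynomial.eval₂_X_pow, Polynomial.eval₂_C]
    exact sub_eq_zero.2 (powMap_of n γ).symm
  | add x y hx hy => exact hx.add _ hy
  | smul r x hx =>
    rw [Algebra.smul_def]
    refine RingHom.IsIntegralElem.mul _ ?_ hx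
    rw [← (powMap K Γ n).commutes]
    exact RingHom.isIntegralElem_map _

end Eval

end CharVar
end

noncomputable section
open Filter Topology
open scoped Nat NNReal

namespace CharVar

/-! ### Orbits of characters on a component -/

section Main

variable {p : ℕ} [hp : Fact p.Prime] {Γ : Type u} [CommGroup Γ]

/-- The restriction of a continuous character to `Γ`. -/
def restrict (χ : Profin Γ →ₜ* (PadicAlgCl p)ˣ) : Γ →* (PadicAlgCl p)ˣ :=
  χ.toMonoidHom.comp Profin.eta

theorem mem_phi (χ : Profin Γ →ₜ* (PadicAlgCl p)ˣ) (f : MonoidAlgebra (PadicAlgCl p) Γ) :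
    f ∈ (phi χ).asIdeal ↔ evalAt (restrict χ) f = 0 := Iff.rfl

theorem iterate_act_apply (σ : Profin Γ ≃ₜ* Profin Γ) (n : ℕ) :
    ∀ (χ : Profin Γ →ₜ* (PadicAlgCl p)ˣ) (g : Profin Γ), ((act σ)^[n] χ) g = χ (σ^[n] g) := by
  induction n with
  | zero => exact fun χ g => rfl
  | succ n ih =>
    intro χ g
    rw [Function.iterate_succ_apply, ih, Function.iterate_succ_apply']
    rfl

theorem residueChar_eq_of_eqOn {χ χ' : Profin Γ →ₜ* (PadicAlgCl p)ˣ} {s : Set Γ}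
    (hs : Subgroup.closure s = ⊤)
    (h : ∀ γ ∈ s, residueChar χ (Profin.eta γ) = residueChar χ' (Profin.eta γ)) :
    residueChar χ = residueChar χ' := by
  refine DFunLike.coe_injective (eq_of_eta_of_isLocallyConstant (isLocallyConstant_residueChar χ)
    (isLocallyConstant_residueChar χ') fun γ => ?_)
  have h1 : (residueChar χ).comp Profin.eta = (residueChar χ').comp (Profin.eta (Γ := Γ)) :=
    MonoidHom.eq_of_eqOn_dense hs h
  exact DFunLike.congr_fun h1 γ

instance : CharP (ResField p) p := by
  rw [CharP.charP_iff_prime_eq_zero hp.out]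
  have h1 : ((p : integers p) : PadicAlgCl p) = (p : PadicAlgCl p) := by simp
  have h2 := (residue_eq_iff (p := p) (p : integers p) 0).2 (by
    rw [h1, ZeroMemClass.coe_zero, sub_zero]
    have h3 := PadicAlgCl.norm_extends p (p : ℚ_[p])
    rw [map_natCast] at h3
    rw [h3]
    exact Padic.norm_p_lt_one)
  simpa using h2

/-- Characters whose `p`-power multiples agree have the same residue character. -/
theorem residueChar_eq_of_pow_eq {χ χ' : Profin Γ →ₜ* (PadicAlgCl p)ˣ} (M : ℕ)
    (h : ∀ γ : Γ, χ (Profin.eta γ) ^ p ^ M = χ' (Profin.eta γ) ^ p ^ M) :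
    residueChar χ = residueChar χ' := by
  refine residueChar_eq_of_eqOn (s := Set.univ) Subgroup.closure_univ fun γ _ => ?_
  have h1 : residueChar χ (Profin.eta γ ^ p ^ M) = residueChar χ' (Profin.eta γ ^ p ^ M) := by
    rw [residueChar_eq_iff, map_pow, map_pow, h, sub_self, norm_zero]
    exact one_pos
  rw [map_pow, map_pow] at h1
  -- The residue field has characteristic `p`, so its Frobenius is injective.
  refine Units.ext (iterateFrobenius_inj (ResField p) p M ?_)
  rw [iterateFrobenius_def, iterateFrobenius_def]
  simpa using congrArg Units.val h1

theorem norm_evalAt_sub_le (w w' : Γ →* (PadicAlgCl p)ˣ) (g : MonoidAlgebra (PadicAlgCl p) Γ)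
    {ε : ℝ} (h : ∀ γ, ‖(w γ : PadicAlgCl p) - w' γ‖ ≤ ε) :
    ‖evalAt w g - evalAt w' g‖ ≤ (∑ γ ∈ g.coeff.support, ‖g.coeff γ‖) * ε := by
  rw [evalAt_apply, evalAt_apply, ← Finset.sum_sub_distrib, Finset.sum_mul]
  refine norm_sum_le_of_le _ fun γ _ => ?_
  rw [← mul_sub, norm_mul]
  gcongr
  exact h γ

/-- If infinitely many points of the orbit of `x` lie in the zero locus of a prime ideal, then this
zero locus contains a character with the same `p`-power multiple as the Teichmüller character. -/
theorem HasWeights.exists_character_pow_eq {Γ₀ : Subgroup Γ} {σ : Profin Γ ≃ₜ* Profin Γ}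
    {α : ℤ_[p]ˣ} (h : HasWeights Γ₀ σ α) (x T : Profin Γ →ₜ* (PadicAlgCl p)ˣ)
    (hxT : residueChar x = residueChar T) (hT : ∀ g, T (σ g) = T g)
    (P : Ideal (MonoidAlgebra (PadicAlgCl p) Γ)) (Z : Set ℕ) (hZ : Z.Infinite)
    (hP : ∀ n ∈ Z, P ≤ (phi ((act σ)^[n] x)).asIdeal) :
    ∃ (M : ℕ) (w : Γ →* (PadicAlgCl p)ˣ), P ≤ (pointOf w).asIdeal ∧
      ∀ γ, w γ ^ p ^ M = T (Profin.eta γ) ^ p ^ M := by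
  obtain ⟨r, hr0, hr⟩ := PadicComplex.exists_summable_expSeries p
  set b : ℤ_[p] := ((α⁻¹ : ℤ_[p]ˣ) : ℤ_[p]) with hb
  have hbinj : Function.Injective fun n : ℕ => b ^ n := by
    have h1 : Function.Injective fun n : ℕ => (α⁻¹ : ℤ_[p]ˣ) ^ n :=
      injective_pow_iff_not_isOfFinOrder.2 fun h0 => h.not_root_of_unity (by simpa using h0.inv)
    intro m n hmn
    exact h1 (Units.ext (by simpa using hmn))
  have hr' : (0 : ℝ) < r := hr0
  -- On the disc of radius `3` the argument `t² l₂` grows by a factor up to `9`, and `9 * (r / 10) <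
  -- r`.
  obtain ⟨M, l₁, l₂, hl₁, hl₂, hinterp⟩ := h.exists_interpolation x T hxT hT b hb
    (show (0 : ℝ) < r / 10 by positivity)
  have hvan : ∀ f, powMap (PadicAlgCl p) Γ (p ^ M) f ∈ P →
      evalAt (restrict T) (powMap (PadicAlgCl p) Γ (p ^ M) f) = 0 := by
    intro f hf
    have hsum := sum_eq_zero_of_interpolation f.coeff.support hr
      (fun γ => ((f.coeff γ * ((T (Profin.eta γ) ^ p ^ M : (PadicAlgCl p)ˣ) : PadicAlgCl p) :
        PadicAlgCl p) : ℂ_[p])) (fun γ => l₁ (Profin.eta γ)) (fun γ => l₂ (Profin.eta γ))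
      (fun γ _ => by linarith [hl₁ (Profin.eta γ)]) (fun γ _ => by linarith [hl₂ (Profin.eta γ)])
      b hZ hbinj (by
        intro n hn
        have h1 := (mem_phi _ _).1 (hP n hn hf)
        rw [evalAt_powMap] at h1
        have h2 := congrArg (algebraMap (PadicAlgCl p) ℂ_[p]) h1
        rw [map_sum, map_zero] at h2
        rw [← h2]
        refine Finset.sum_congr rfl fun γ _ => ?_
        have h3 : restrict ((act σ)^[n] x) γ = x (σ^[n] (Profin.eta γ)) :=
          iterate_act_apply σ n x _
        have h4 := hinterp n (Profin.eta γ)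
        rw [PadicComplex.coe_eq, PadicComplex.coe_eq] at h4
        rw [h3, map_mul, h4, PadicComplex.coe_eq, map_mul, mul_assoc])
    simp_rw [PadicComplex.coe_eq] at hsum
    rw [← map_sum, map_eq_zero] at hsum
    rw [evalAt_powMap]
    exact hsum
  have hpM : 0 < p ^ M := pow_pos hp.out.pos M
  let μ : MonoidAlgebra (PadicAlgCl p) Γ →+* MonoidAlgebra (PadicAlgCl p) Γ :=
    (powMap (PadicAlgCl p) Γ (p ^ M) :)
  let τ : MonoidAlgebra (PadicAlgCl p) Γ →+* PadicAlgCl p := (evalAt (restrict T) :)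
  -- By `hvan`, the point `T ^ p ^ M` satisfies the equations of the image of the zero locus of `P`
  -- under the power map; integrality lifts it to that zero locus.
  obtain ⟨B, hB⟩ := exists_ringHom_comp_eq_of_isIntegral ((Ideal.Quotient.mk P).comp μ)
    ((powMap_isIntegral hpM).trans _ _
      (RingHom.isIntegral_of_surjective _ Ideal.Quotient.mk_surjective)) (τ.comp μ)
    (fun f hf => hvan f (Ideal.Quotient.eq_zero_iff_mem.1 hf))
  have hB' : ∀ f, B (Ideal.Quotient.mk P (powMap (PadicAlgCl p) Γ (p ^ M) f)) =
      evalAt (restrict T) (powMap (PadicAlgCl p) Γ (p ^ M) f) := fun f => DFunLike.congr_fun hB f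
  let B₁ : MonoidAlgebra (PadicAlgCl p) Γ →ₐ[PadicAlgCl p] PadicAlgCl p :=
    ⟨B.comp (Ideal.Quotient.mk P), fun c => by
      have h1 := hB' (algebraMap _ _ c)
      rw [AlgHom.commutes, AlgHom.commutes] at h1
      exact h1⟩
  obtain ⟨w, hw⟩ := exists_eq_evalAt B₁
  refine ⟨M, w, fun f hf => ?_, fun γ => ?_⟩
  · rw [mem_pointOf, hw]
    change B (Ideal.Quotient.mk P f) = 0
    rw [Ideal.Quotient.eq_zero_iff_mem.2 hf, map_zero]
  · refine Units.ext ?_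
    have h1 := hB' (MonoidAlgebra.of (PadicAlgCl p) Γ γ)
    have h2 : evalAt w (powMap (PadicAlgCl p) Γ (p ^ M) (MonoidAlgebra.of (PadicAlgCl p) Γ γ)) =
        B (Ideal.Quotient.mk P (powMap (PadicAlgCl p) Γ (p ^ M)
          (MonoidAlgebra.of (PadicAlgCl p) Γ γ))) := DFunLike.congr_fun hw _
    rw [h1, powMap_of, map_pow, map_pow, evalAt_of, evalAt_of] at h2
    rw [Units.val_pow_eq_pow_val, h2]
    rfl

variable [Group.FG Γ]

/-- Continuous characters with a given residue character are dense in the irreducible closed subsets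
they meet. -/
theorem exists_character_evalAt_ne_zero (P : Ideal (MonoidAlgebra (PadicAlgCl p) Γ)) [P.IsPrime]
    (g : MonoidAlgebra (PadicAlgCl p) Γ) (hg : g ∉ P) (χ : Profin Γ →ₜ* (PadicAlgCl p)ˣ)
    (hχ : P ≤ (phi χ).asIdeal) : ∃ x : Profin Γ →ₜ* (PadicAlgCl p)ˣ,
      residueChar x = residueChar χ ∧ P ≤ (phi x).asIdeal ∧ evalAt (restrict x) g ≠ 0 := by
  obtain ⟨_, S, -, hS⟩ := Group.fg_iff'.1 (inferInstance : Group.FG Γ)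
  obtain ⟨F, hF, hFg, hFr⟩ := exists_filter_tendsto_algHom
    (R := MonoidAlgebra (PadicAlgCl p) Γ ⧸ P)
    (Ideal.Quotient.liftₐ P (evalAt (restrict χ)) fun a ha => hχ ha) (Ideal.Quotient.mk P g)
    (by rwa [ne_eq, Ideal.Quotient.eq_zero_iff_mem])
  -- Distance below one on generators gives the same residues and forces values of norm one.
  have hclose : ∀ᶠ y in F, ∀ s ∈ S, ‖y (Ideal.Quotient.mk P (MonoidAlgebra.of _ Γ s)) -
      ((χ (Profin.eta s) : (PadicAlgCl p)ˣ) : PadicAlgCl p)‖ < 1 := by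
    rw [eventually_all_finset]
    intro s _
    have h1 := Metric.tendsto_nhds.1
      (hFr (Ideal.Quotient.mk P (MonoidAlgebra.of (PadicAlgCl p) Γ s))) 1 one_pos
    filter_upwards [h1] with y hy
    rw [dist_eq_norm] at hy
    have h2 : Ideal.Quotient.liftₐ P (evalAt (restrict χ)) (fun a ha => hχ ha)
        (Ideal.Quotient.mk P (MonoidAlgebra.of (PadicAlgCl p) Γ s)) =
        ((χ (Profin.eta s) : (PadicAlgCl p)ˣ) : PadicAlgCl p) := evalAt_of (restrict χ) s
    rwa [h2] at hy
  obtain ⟨y, hyg, hyS⟩ := (hFg.and hclose).exists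
  obtain ⟨w, hw⟩ := exists_eq_evalAt (y.comp (Ideal.Quotient.mkₐ (PadicAlgCl p) P))
  have hwS : ∀ s ∈ S, ‖(w s : PadicAlgCl p) - χ (Profin.eta s)‖ < 1 := by
    intro s hs
    rw [← evalAt_of, hw]
    exact hyS s hs
  have hw1 : ∀ γ, ‖(w γ : PadicAlgCl p)‖ = 1 := by
    let N : Subgroup Γ :=
      { carrier := {γ | ‖(w γ : PadicAlgCl p)‖ = 1}
        one_mem' := by simp
        mul_mem' := fun {a b} ha hb => by
          rw [Set.mem_ofPred_eq] at ha hb ⊢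
          rw [map_mul, Units.val_mul, norm_mul, ha, hb, one_mul]
        inv_mem' := fun {a} ha => by
          rw [Set.mem_ofPred_eq] at ha ⊢
          rw [map_inv, Units.val_inv_eq_inv_val, norm_inv, ha, inv_one] }
    have h1 : Subgroup.closure (S : Set Γ) ≤ N := by
      rw [Subgroup.closure_le]
      intro s hs
      have h2 := IsUltrametricDist.norm_eq_of_add_norm_lt_max (x := (w s : PadicAlgCl p))
        (y := -χ (Profin.eta s)) (by
          rw [← sub_eq_add_neg, norm_neg]
          exact lt_max_of_lt_right
            ((hwS s hs).trans_eq (norm_apply_eq_one χ (Profin.eta s)).symm))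
      exact h2.trans ((norm_neg _).trans (norm_apply_eq_one χ _))
    exact fun γ => h1 (hS ▸ Subgroup.mem_top γ)
  obtain ⟨x, hx⟩ := exists_continuous_extension w hw1
  have hxw : restrict x = w := MonoidHom.ext hx
  refine ⟨x, residueChar_eq_of_eqOn hS fun s hs => ?_, fun a ha => ?_, ?_⟩
  · rw [residueChar_eq_iff, hx]
    exact hwS s hs
  · rw [mem_phi, hxw, hw, AlgHom.comp_apply, Ideal.Quotient.mkₐ_eq_mk,
      Ideal.Quotient.eq_zero_iff_mem.2 ha, map_zero]
  · rw [hxw, hw]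
    exact hyg

/-- A function that does not vanish at a continuous character does not vanish at the multiples of a
suitable iterate of `σ`. -/
theorem exists_iterate_evalAt_ne_zero (σ : Profin Γ ≃ₜ* Profin Γ)
    (x : Profin Γ →ₜ* (PadicAlgCl p)ˣ) (g : MonoidAlgebra (PadicAlgCl p) Γ)
    (hg : evalAt (restrict x) g ≠ 0) :
    ∃ m : ℕ, 0 < m ∧ ∀ k, evalAt (restrict ((act σ)^[m * k] x)) g ≠ 0 := by
  have hC0 : 0 ≤ ∑ γ ∈ g.coeff.support, ‖g.coeff γ‖ := Finset.sum_nonneg fun _ _ => norm_nonneg _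
  have hpos : 0 < ‖evalAt (restrict x) g‖ := norm_pos_iff.2 hg
  -- Moving the character by at most this amount changes the value of `g` by less than its norm at
  -- `x`; the added `1` keeps the denominator positive.
  obtain ⟨m, hm, hmk⟩ := exists_recurrence (σ := σ) x
    (div_pos hpos (add_pos_of_nonneg_of_pos hC0 one_pos))
  refine ⟨m, hm, fun k h0 => ?_⟩
  have h1 := norm_evalAt_sub_le (restrict ((act σ)^[m * k] x)) (restrict x) g (fun γ => by
    have h2 := (hmk k (Profin.eta γ)).le
    rw [← iterate_act_apply] at h2
    exact h2)
  rw [h0, zero_sub, norm_neg, mul_div_assoc', le_div_iff₀ (add_pos_of_nonneg_of_pos hC0 one_pos)] at h1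
  linarith

end Main

end CharVar
end

/-! ### The torsion character on a component -/

theorem proposition4p2 {p : ℕ} [Fact p.Prime]
    {Γ : Type u} [CommGroup Γ] [Group.FG Γ] (Γ₀ : Subgroup Γ)
    (σ : CharVar.Profin Γ ≃ₜ* CharVar.Profin Γ) (α : ℤ_[p]ˣ)
    (hσ : CharVar.HasWeights Γ₀ σ α)
    (ξ : CharVar.Profin Γ →* (CharVar.ResField p)ˣ)
    (hξ : IsLocallyConstant ξ)
    (hξσ : ξ.comp (σ : CharVar.Profin Γ →* CharVar.Profin Γ) = ξ)
    (S : Set (CharVar.CharSpace Γ (PadicAlgCl p))) (hS : IsClosed S)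
    (hSσ : CharVar.act σ '' (CharVar.phi ⁻¹' S ∩ CharVar.fibre ξ) =
      CharVar.phi ⁻¹' S ∩ CharVar.fibre ξ)
    (S' : Set (CharVar.CharSpace Γ (PadicAlgCl p))) (hS' : CharVar.IsComponentOf S' S)
    (hne : (CharVar.phi ⁻¹' S' ∩ CharVar.fibre ξ).Nonempty) :
    ∃ χ : CharVar.Profin Γ →ₜ* (PadicAlgCl p)ˣ,
      CharVar.phi χ ∈ S' ∧ IsOfFinOrder χ ∧ CharVar.residueChar χ = ξ := by
  have _ : IsNoetherianRing (MonoidAlgebra (PadicAlgCl p) Γ) :=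
    Algebra.FiniteType.isNoetherianRing (PadicAlgCl p) _
  obtain ⟨hSS, P, g, hP, hPS, hgP, hgS⟩ := hS'.exists_prime hS
  obtain ⟨χ₀, hχ₀, hχ₀ξ⟩ := hne
  obtain ⟨x, hxres, hxP, hxg⟩ :=
    CharVar.exists_character_evalAt_ne_zero P g hgP χ₀ ((hPS _).1 hχ₀)
  have hxξ : CharVar.residueChar x = ξ := hxres.trans hχ₀ξ
  obtain ⟨T, hTξ, ⟨Q, hQ, hTQ⟩, hTker⟩ := CharVar.exists_teichmuller ξ hξ
  have hTσ : ∀ h, T (σ h) = T h := fun h => hTker _ _ (DFunLike.congr_fun hξσ h)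
  obtain ⟨m, hm, hmk⟩ := CharVar.exists_iterate_evalAt_ne_zero σ x g hxg
  have horbit : ∀ n, (CharVar.act σ)^[n] x ∈ CharVar.phi ⁻¹' S ∩ CharVar.fibre ξ := by
    intro n
    induction n with
    | zero => exact ⟨hSS ((hPS _).2 hxP), hxξ⟩
    | succ n ih =>
      rw [Function.iterate_succ_apply', ← hSσ]
      exact ⟨_, ih, rfl⟩
  -- At the multiples of `m` the iterates stay in `S` and `g` does not vanish, so they lie on `S'`.
  obtain ⟨M, w, hwP, hwT⟩ := hσ.exists_character_pow_eq x T (hxξ.trans hTξ.symm) hTσ P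
    (Set.range fun k => m * k)
    (Set.infinite_range_of_injective fun _ _ hab => Nat.eq_of_mul_eq_mul_left hm hab)
    (by
      rintro _ ⟨k, rfl⟩
      exact (hPS _).1 (hgS _ (horbit _).1 (hmk k)))
  have hw1 : ∀ γ, ‖(w γ : PadicAlgCl p)‖ = 1 := by
    intro γ
    have h1 := congrArg (fun u : (PadicAlgCl p)ˣ => ‖(u : PadicAlgCl p)‖) (hwT γ)
    simp only [Units.val_pow_eq_pow_val, norm_pow, CharVar.norm_apply_eq_one, one_pow] at h1
    exact (pow_eq_one_iff_of_nonneg (norm_nonneg _)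
      (pow_ne_zero _ (Fact.out : p.Prime).ne_zero)).1 h1
  obtain ⟨χ, hχ⟩ := CharVar.exists_continuous_extension w hw1
  have hχw : CharVar.restrict χ = w := MonoidHom.ext hχ
  have hpow : ∀ γ, χ (CharVar.Profin.eta γ) ^ p ^ M = T (CharVar.Profin.eta γ) ^ p ^ M := by
    intro γ
    rw [hχ, hwT]
  refine ⟨χ, (hPS _).2 fun f hf => ?_, ?_, (CharVar.residueChar_eq_of_pow_eq M hpow).trans hTξ⟩
  · rw [CharVar.mem_phi, hχw]
    exact hwP hf
  · rw [isOfFinOrder_iff_pow_eq_one]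
    refine ⟨p ^ M * Q, Nat.mul_pos (pow_pos (Fact.out : p.Prime).pos M) hQ,
      CharVar.ext_of_eta fun γ => ?_⟩
    rw [ContinuousMonoidHom.pow_apply, pow_mul, hpow, ← pow_mul, mul_comm, pow_mul, hTQ, one_pow]
    rfl
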